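/- **Setting.** Let $n_1,\dots,n_K\ge 2$ be cluster sizes, $n=\sum_k n_k$, and index the coordinates of $z\in\mathbb R^n$ by pairs $(k,i)$, $1\le k\le K$, $1\le i\le n_k$; write $z_k\in\mathbb R^{n_k}$ for the $k$-th sub-vector. Let $C$ be a positive definite block correlation matrix: its diagonal entries are $1$, and its entry at two different positions $(k,i),(l,j)$ is $\rho_{kl}$. Define the $K\times K$ matrix $A$ by $A_{kl}=\rho_{kl}\sqrt{n_kn_l}$ for $k\ne l$ and $A_{kk}=1+(n_k-1)\rho_{kk}$, so that $C=C(A)$ is a function of $A$, and put $\lambda_k=(n_k-A_{kk})/(n_k-1)$. Square roots $M^{1/2}$ are principal square roots (the symmetric positive definite root if $M$ is symmetric positive definite), and $M^{-1/2}=(M^{1/2})^{-1}$. Let $\nu_{k,i}>2$, and let $Z=C^{1/2}V$ in distribution, where the coordinates $V_{k,i}$ are independent and standardized univariate $t$-distributed, with density $$f_\nu(y)=\tfrac{\Gamma((\nu+1)/2)}{\Gamma(\nu/2)}[(\nu-2)\pi]^{-1/2}\Big(1+\tfrac{y^2}{\nu-2}\Big)^{-(\nu+1)/2},\qquad \nu=\nu_{k,i}$$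 (the Hetero-$t$ distribution). With $U=C^{-1/2}Z$ the log-likelihood is $$\ell(Z)=-\tfrac12\log|C|+\sum_{k=1}^K\sum_{i=1}^{n_k}\log f_{\nu_{k,i}}(U_{k,i}),\qquad C=C(A).$$ Let $\nabla_A=\partial\ell/\partial\mathrm{vec}(A)$, where $\ell$ is differentiated with respect to all $K^2$ entries of $A$, and $\mathcal I_A=\mathbb E(\nabla_A\nabla_A')$. Here $\mathrm{vec}$ stacks columns, $\otimes$ is the Kronecker product, $A\oplus B=A\otimes B+B\otimes A$, $K_K$ is the commutation matrix ($K_K\mathrm{vec}(B)=\mathrm{vec}(B')$), $E_d$ is the $K\times K^2$ matrix with $E_d\mathrm{vec}(B)=\mathrm{diag}(B)$, $e_k$ and $\tilde e_i$ are the columns of $I_K$ and $I_{n_k}$, $J_k^e=e_ke_k'$, $J_{k\otimes}^e=J_k^e\otimes J_k^e$, $v_{n_k}=n_k^{-1/2}(1,\dots,1)'\in\mathbb R^{n_k}$, $X_0=A^{-1/2}Y_0$ with $Y_{0,k}=v_{n_k}'Z_k$, and $\Omega_A=(I_K\otimes A^{-1/2})(A^{1/2}\oplus I_K)^{-1}$.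 **Theorem.** For every value of $Z$, $\ell$ is differentiable in $\mathrm{vec}(A)$, and $$\nabla_A=\Omega_A\Big[\sum_{k=1}^K\sum_{i=1}^{n_k}W_{k,i}U_{k,i}\,\mathrm{vec}(e_kX_0')\,n_k^{-1/2}-\mathrm{vec}(I_K)\Big]+\tfrac12E_d'S,$$ where $$W_{k,i}=\frac{\nu_{k,i}+1}{\nu_{k,i}-2+U_{k,i}^2},\qquad S_k=\frac1{\lambda_k}-\frac{\sum_{i=1}^{n_k}W_{k,i}U_{k,i}F_{k,i}U_k}{(n_k-1)\lambda_k},\qquad F_{k,i}=\tilde e_i'(I_{n_k}-v_{n_k}v_{n_k}').$$ The products of the coordinates of $\nabla_A$ are integrable, and $$\mathcal I_A=\Omega_A(K_K+\Upsilon_K^e)\Omega_A+\tfrac14E_d'\Xi E_d+\tfrac12E_d'\Theta\Omega_A+\tfrac12\Omega_A\Theta'E_d,$$ where $\Upsilon_K^e=\sum_{k=1}^K\Psi_k^e$ with $$\Psi_k^e=n_k^{-1}(3\bar\phi_k-2-\bar\psi_k)J_{k\otimes}^e+\bar\psi_k(I_K\otimes J_k^e),$$ $$\bar\phi_k=\frac1{n_k}\sum_{i=1}^{n_k}\phi_{k,i},\quad\bar\psi_k=\frac1{n_k}\sum_{i=1}^{n_k}\psi_{k,i},\quad\phi_{k,i}=\frac{\nu_{k,i}+1}{\nu_{k,i}+3},\quad\psi_{k,i}=\phi_{k,i}\frac{\nu_{k,i}}{\nu_{k,i}-2},$$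 $\Xi$ is the $K\times K$ diagonal matrix with $$\Xi_{kk}=\lambda_k^{-2}n_k^{-1}\big[3\bar\phi_k-1+(\bar\psi_k+1)(n_k-1)^{-1}\big],$$ and $\Theta$ is the $K\times K^2$ matrix $$\Theta=\sum_{k=1}^K\lambda_k^{-1}n_k^{-1}(\bar\psi_k+2-3\bar\phi_k)\,e_k\,\mathrm{vec}(J_k^e)'.$$ -/

import Mathlib

open MeasureTheory ProbabilityTheory Matrix
open scoped Kronecker

namespace HeteroBlock

noncomputable section

/-! ### Matrix notions -/

/-- `R` is the principal square root of the real square matrix `M`: it squares to `M` and all its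
(complex) eigenvalues have positive real part. For a symmetric positive definite `M` this is the
symmetric positive definite square root; for `M` near such a matrix it is the root that depends
smoothly on all entries of `M`, symmetric or not. -/
def IsPrincipalSqrt {ι : Type*} [Fintype ι] [DecidableEq ι] (M R : Matrix ι ι ℝ) : Prop :=
  R * R = M ∧ ∀ z ∈ spectrum ℂ (R.map (algebraMap ℝ ℂ)), 0 < z.re

open Classical in
/-- `M^{1/2}`: the principal square root (it is unique where it exists; `0` where there is none). -/
def sqrtm {ι : Type*} [Fintype ι] [DecidableEq ι] (M : Matrix ι ι ℝ) : Matrix ι ι ℝ :=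
  if h : ∃ R, IsPrincipalSqrt M R then h.choose else 0

/-- `M^{-1/2}`. -/
def invSqrtm {ι : Type*} [Fintype ι] [DecidableEq ι] (M : Matrix ι ι ℝ) : Matrix ι ι ℝ :=
  (sqrtm M)⁻¹

/-- The inverse of `Matrix.vec`. -/
def unvec {ι : Type*} (a : ι × ι → ℝ) : Matrix ι ι ℝ :=
  Matrix.of fun i j => a (j, i)

/-- `A ⊕ B = A ⊗ B + B ⊗ A`. -/
def kronPlus {ι : Type*} (A B : Matrix ι ι ℝ) : Matrix (ι × ι) (ι × ι) ℝ :=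
  A ⊗ₖ B + B ⊗ₖ A

/-- The commutation matrix: `K vec(B) = vec(B')`. -/
def commMat (ι : Type*) [DecidableEq ι] : Matrix (ι × ι) (ι × ι) ℝ :=
  Matrix.of fun p q => if p = q.swap then 1 else 0

/-- The elimination matrix of the diagonal: `E_d vec(B) = diag(B)`. -/
def elimDiag (ι : Type*) [DecidableEq ι] : Matrix ι (ι × ι) ℝ :=
  Matrix.of fun k p => if p = (k, k) then 1 else 0

theorem commMat_mulVec_vec {ι : Type*} [Fintype ι] [DecidableEq ι] (B : Matrix ι ι ℝ) :
    commMat ι *ᵥ vec B = vec Bᵀ := by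
  ext ⟨i, j⟩
  have h : ∀ q : ι × ι, ((i, j) = q.swap) ↔ (q = (j, i)) := by
    rintro ⟨a, b⟩
    simp only [Prod.swap_prod_mk, Prod.mk.injEq]
    constructor
    · rintro ⟨rfl, rfl⟩; exact ⟨rfl, rfl⟩
    · rintro ⟨rfl, rfl⟩; exact ⟨rfl, rfl⟩
  simp [commMat, Matrix.mulVec, dotProduct, h, vec]

theorem elimDiag_mulVec_vec {ι : Type*} [Fintype ι] [DecidableEq ι] (B : Matrix ι ι ℝ) :
    elimDiag ι *ᵥ vec B = B.diag := by
  ext k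
  simp [elimDiag, Matrix.mulVec, dotProduct, vec]

/-! ### Block correlation matrices and their canonical form -/

/-- The index set of the `n₁ + ⋯ + n_K` variables: the `i`-th variable of the `k`-th cluster. -/
abbrev Idx {K : ℕ} (n : Fin K → ℕ) : Type := (k : Fin K) × Fin (n k)

/-- The matrix with ones on the diagonal whose other entries in the block `(k, l)` are `ρ k l`. -/
def blockCorr {K : ℕ} (n : Fin K → ℕ) (ρ : Matrix (Fin K) (Fin K) ℝ) :
    Matrix (Idx n) (Idx n) ℝ :=
  Matrix.of fun x y => if x = y then 1 else ρ x.1 y.1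

/-- The `K × K` block `A` of the canonical form: `A_{kl} = ρ_{kl} √(n_k n_l)` for `k ≠ l`, and
`A_{kk} = 1 + (n_k - 1) ρ_{kk}`. -/
def canonA {K : ℕ} (n : Fin K → ℕ) (ρ : Matrix (Fin K) (Fin K) ℝ) : Matrix (Fin K) (Fin K) ℝ :=
  Matrix.of fun k l =>
    if k = l then 1 + ((n k : ℝ) - 1) * ρ k k else ρ k l * √((n k : ℝ) * (n l : ℝ))

/-- The coefficients `ρ` recovered from `A`. -/
def rhoOfA {K : ℕ} (n : Fin K → ℕ) (A : Matrix (Fin K) (Fin K) ℝ) : Matrix (Fin K) (Fin K) ℝ :=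
  Matrix.of fun k l =>
    if k = l then (A k k - 1) / ((n k : ℝ) - 1) else A k l / √((n k : ℝ) * (n l : ℝ))

theorem rhoOfA_canonA {K : ℕ} (n : Fin K → ℕ) (hn : ∀ k, 2 ≤ n k)
    (ρ : Matrix (Fin K) (Fin K) ℝ) : rhoOfA n (canonA n ρ) = ρ := by
  have h2 : ∀ k, (2 : ℝ) ≤ n k := fun k => by exact_mod_cast hn k
  ext k l
  by_cases h : k = l
  · subst h
    have : (n k : ℝ) - 1 ≠ 0 := by have := h2 k; intro h; linarith
    simp [rhoOfA, canonA, this]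
  · have h1 : (0 : ℝ) < n k := by have := h2 k; linarith
    have h3 : (0 : ℝ) < n l := by have := h2 l; linarith
    have : √((n k : ℝ) * (n l : ℝ)) ≠ 0 := by positivity
    simp only [rhoOfA, canonA, Matrix.of_apply, h, if_false]
    field_simp

/-- `λ_k = (n_k - A_{kk}) / (n_k - 1)`. -/
def lam {K : ℕ} (n : Fin K → ℕ) (A : Matrix (Fin K) (Fin K) ℝ) (k : Fin K) : ℝ :=
  ((n k : ℝ) - A k k) / ((n k : ℝ) - 1)

/-- The block matrix `C` as a function of `A`. -/
def corrOfA {K : ℕ} (n : Fin K → ℕ) (A : Matrix (Fin K) (Fin K) ℝ) : Matrix (Idx n) (Idx n) ℝ :=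
  blockCorr n (rhoOfA n A)

/-- `v_{n_k} = (1/√n_k, …, 1/√n_k)'`. -/
def unitVec (m : ℕ) : Fin m → ℝ := fun _ => 1 / √(m : ℝ)

/-- `Y₀ = (v_{n_1}' Z_1, …, v_{n_K}' Z_K)'`, the first `K` canonical variables. -/
def Y0 {K : ℕ} (n : Fin K → ℕ) (z : Idx n → ℝ) : Fin K → ℝ :=
  fun k => unitVec (n k) ⬝ᵥ fun i => z ⟨k, i⟩

/-- `X₀ = A^{-1/2} Y₀`. -/
def X0 {K : ℕ} (n : Fin K → ℕ) (A : Matrix (Fin K) (Fin K) ℝ) (z : Idx n → ℝ) : Fin K → ℝ :=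
  invSqrtm A *ᵥ Y0 n z

/-! ### The Hetero-`t` distribution -/

/-- Density of the standardized univariate `t`-distribution (variance one) with `ν > 2` degrees of
freedom. -/
def tStdPDF (ν y : ℝ) : ℝ :=
  Real.Gamma ((ν + 1) / 2) / Real.Gamma (ν / 2) * ((ν - 2) * Real.pi) ^ (-(1 / 2) : ℝ) *
    (1 + y ^ 2 / (ν - 2)) ^ (-((ν + 1) / 2))

/-- The standardized univariate `t`-distribution. -/
def tStd (ν : ℝ) : Measure ℝ :=
  volume.withDensity fun y => ENNReal.ofReal (tStdPDF ν y)

/-- The law of `S V` where the coordinates `V_i` of `V` are independent and standardized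
`t`-distributed with `ν_i` degrees of freedom. -/
def heteroT {ι : Type*} [Fintype ι] (ν : ι → ℝ) (S : Matrix ι ι ℝ) : Measure (ι → ℝ) :=
  (Measure.pi fun i => tStd (ν i)).map fun v => S *ᵥ v

/-- `U = C^{-1/2} Z`. -/
def stdU {ι : Type*} [Fintype ι] [DecidableEq ι] (C : Matrix ι ι ℝ) (z : ι → ℝ) : ι → ℝ :=
  invSqrtm C *ᵥ z

/-- The log-likelihood `ℓ(Z) = -½ log|C| + ℓ(U)` of the correlation matrix `C`, where `ℓ(U)` is the
log-density of the independent `t`-distributed coordinates of `U = C^{-1/2} Z`. -/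
def logLik {ι : Type*} [Fintype ι] [DecidableEq ι] (ν : ι → ℝ) (C : Matrix ι ι ℝ) (z : ι → ℝ) : ℝ :=
  -(1 / 2) * Real.log C.det + ∑ i, Real.log (tStdPDF (ν i) (stdU C z i))

/-- The log-likelihood of the block matrix as a function of `a = vec(A)`. -/
def logLikVecA {K : ℕ} (n : Fin K → ℕ) (ν : Idx n → ℝ) (z : Idx n → ℝ)
    (a : Fin K × Fin K → ℝ) : ℝ :=
  logLik ν (corrOfA n (unvec a)) z

/-- The score `∇_A = ∂ℓ/∂vec(A)`: the vector of partial derivatives with respect to the `K²`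
entries of `A`. -/
def scoreA {K : ℕ} (n : Fin K → ℕ) (ν : Idx n → ℝ) (A : Matrix (Fin K) (Fin K) ℝ) (z : Idx n → ℝ) :
    Fin K × Fin K → ℝ :=
  fun p => fderiv ℝ (logLikVecA n ν z) (vec A) (Pi.single p 1)

/-- The information matrix `𝓘_A = 𝔼(∇_A ∇_A')`. -/
def infoA {K : ℕ} (n : Fin K → ℕ) (ν : Idx n → ℝ) (A : Matrix (Fin K) (Fin K) ℝ)
    {Ω : Type*} [MeasurableSpace Ω] (P : Measure Ω) (Z : Ω → Idx n → ℝ) :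
    Matrix (Fin K × Fin K) (Fin K × Fin K) ℝ :=
  Matrix.of fun p q => ∫ ω, scoreA n ν A (Z ω) p * scoreA n ν A (Z ω) q ∂P

/-! ### The quantities in the closed forms -/

/-- `Ω_A = (I ⊗ A^{-1/2}) (A^{1/2} ⊕ I)^{-1}`. -/
def OmegaA {K : ℕ} (A : Matrix (Fin K) (Fin K) ℝ) :
    Matrix (Fin K × Fin K) (Fin K × Fin K) ℝ :=
  ((1 : Matrix (Fin K) (Fin K) ℝ) ⊗ₖ invSqrtm A) * (kronPlus (sqrtm A) 1)⁻¹

/-- `W_{k,i} = (ν_{k,i} + 1) / (ν_{k,i} - 2 + U_{k,i}²)`. -/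
def weight {ι : Type*} (ν u : ι → ℝ) (x : ι) : ℝ :=
  (ν x + 1) / (ν x - 2 + u x ^ 2)

/-- The row vector `F_{k,i} = ẽ_i' (I - v v')`, `v = v_{n_k}`, `m = n_k`. -/
def Frow (m : ℕ) (i : Fin m) : Fin m → ℝ :=
  Pi.single i 1 ᵥ* (1 - vecMulVec (unitVec m) (unitVec m))

/-- `S_k = 1/λ_k - (∑_i W_{k,i} U_{k,i} F_{k,i} U_k) / ((n_k - 1) λ_k)`. -/
def Svec {K : ℕ} (n : Fin K → ℕ) (ν : Idx n → ℝ) (A : Matrix (Fin K) (Fin K) ℝ) (u : Idx n → ℝ) :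
    Fin K → ℝ :=
  fun k => 1 / lam n A k -
    (∑ i : Fin (n k), weight ν u ⟨k, i⟩ * u ⟨k, i⟩ * (Frow (n k) i ⬝ᵥ fun j => u ⟨k, j⟩)) /
      (((n k : ℝ) - 1) * lam n A k)

/-- `φ = (ν + 1) / (ν + 3)`. -/
def phi (ν : ℝ) : ℝ := (ν + 1) / (ν + 3)

/-- `ψ = φ ν / (ν - 2)`. -/
def psi (ν : ℝ) : ℝ := phi ν * (ν / (ν - 2))

/-- `φ̄_k`. -/
def phiBar {K : ℕ} (n : Fin K → ℕ) (ν : Idx n → ℝ) (k : Fin K) : ℝ :=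
  (1 / (n k : ℝ)) * ∑ i : Fin (n k), phi (ν ⟨k, i⟩)

/-- `ψ̄_k`. -/
def psiBar {K : ℕ} (n : Fin K → ℕ) (ν : Idx n → ℝ) (k : Fin K) : ℝ :=
  (1 / (n k : ℝ)) * ∑ i : Fin (n k), psi (ν ⟨k, i⟩)

/-- `e_k`, the `k`-th column of the identity matrix. -/
def stdVec {K : ℕ} (k : Fin K) : Fin K → ℝ := Pi.single k 1

/-- `J_k = e_k e_k'`. -/
def Jmat {K : ℕ} (k : Fin K) : Matrix (Fin K) (Fin K) ℝ := vecMulVec (stdVec k) (stdVec k)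

/-- `Υ = ∑_k Ψ_k` with `Ψ_k = n_k⁻¹ (3 φ̄_k - 2 - ψ̄_k) J_k ⊗ J_k + ψ̄_k (I ⊗ J_k)`. -/
def Upsilon {K : ℕ} (n : Fin K → ℕ) (ν : Idx n → ℝ) :
    Matrix (Fin K × Fin K) (Fin K × Fin K) ℝ :=
  ∑ k, (((n k : ℝ)⁻¹ * (3 * phiBar n ν k - 2 - psiBar n ν k)) • (Jmat k ⊗ₖ Jmat k) +
    psiBar n ν k • ((1 : Matrix (Fin K) (Fin K) ℝ) ⊗ₖ Jmat k))

/-- The diagonal matrix `Ξ` with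
`Ξ_{kk} = λ_k⁻² n_k⁻¹ [3 φ̄_k - 1 + (ψ̄_k + 1) (n_k - 1)⁻¹]`. -/
def Xi {K : ℕ} (n : Fin K → ℕ) (ν : Idx n → ℝ) (A : Matrix (Fin K) (Fin K) ℝ) :
    Matrix (Fin K) (Fin K) ℝ :=
  Matrix.diagonal fun k => (lam n A k ^ 2)⁻¹ * (n k : ℝ)⁻¹ *
    (3 * phiBar n ν k - 1 + (psiBar n ν k + 1) * ((n k : ℝ) - 1)⁻¹)

/-- `Θ = ∑_k λ_k⁻¹ n_k⁻¹ (ψ̄_k + 2 - 3 φ̄_k) e_k vec(J_k)'`. -/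
def Theta {K : ℕ} (n : Fin K → ℕ) (ν : Idx n → ℝ) (A : Matrix (Fin K) (Fin K) ℝ) :
    Matrix (Fin K) (Fin K × Fin K) ℝ :=
  ∑ k, ((lam n A k)⁻¹ * (n k : ℝ)⁻¹ * (psiBar n ν k + 2 - 3 * phiBar n ν k)) •
    vecMulVec (stdVec k) (vec (Jmat k))

end

end HeteroBlock

/-! Let `V` be the matrix of normalized cluster indicators (`clusterMat`), so that `V'V = 1`, and
let `P = 1 - VV'`. The whole argument rests on the canonical form `C(A) = V A V' + diag(λ) P`
(`corrOfA_eq_blockMat`): `C` acts as `A` on cluster means and as the scalar `λ_k` on deviations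
inside cluster `k`. Such matrices multiply componentwise (`blockMat_mul_blockMat`), so roots and
inverses are taken componentwise, and `U = V A^{-1/2} Y₀ + diag(λ)^{-1/2} P z`.

Score. All `K²` entries of `A` vary, so symmetry is lost near `A`. The substitute for positive
definiteness is accretivity, an open condition that forces the spectrum into the right half plane.
Two principal roots then coincide, since the Sylvester operator `X ↦ RX + XT` is injective; the same
injectivity lets the inverse function theorem supply a smooth local root, which must be `sqrtm`
(`sqrtm_unvec_regular`). In a direction `H` the root has derivative `D` with `A^{1/2} D + D A^{1/2}
= H`, the determinant follows Jacobi's formula, and the chain rule gives `exists_fderiv_logLikVecA`.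
The matrix `Ω_A` encodes `H ↦ A^{-1/2} D` and is symmetric, which turns directional derivatives into
the gradient (`scoreA_eq`).

Information. Let `h_x = W_x U_x`. Since `X₀ = V'U`, the score is a fixed linear map `scoreLin`
applied to the centred products `h_x U_y - δ_{xy}`. Independence and the symmetry of the `t` density
reduce their covariance to `E[hU] = 1`, `E[U²] = 1`, `E[h²] = ψ` and `E[h²U²] = 3φ`
(`prod_tMoment`). Conjugating this covariance by the mean part and the deviation part of the score
produces `K_K + Υ`, `Ξ` and `Θ`; the relation `PV = 0` removes most of the cross term. -/

namespace HeteroBlock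

/-- A real square matrix whose quadratic form is positive away from zero. -/
def Accretive {ι : Type*} [Fintype ι] (B : Matrix ι ι ℝ) : Prop :=
  ∀ x : ι → ℝ, x ≠ 0 → 0 < x ⬝ᵥ B *ᵥ x

theorem _root_.Matrix.PosDef.accretive {ι : Type*} [Fintype ι] {R : Matrix ι ι ℝ}
    (hR : R.PosDef) : Accretive R :=
  fun x hx => by simpa using hR.dotProduct_mulVec_pos hx

/-- By homogeneity positivity is only needed on the unit sphere, and compactness of the sphere makes
it an open condition. -/
theorem eventually_accretive {ι : Type*} [Fintype ι] {R : Matrix ι ι ℝ} (hR : Accretive R) :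
    ∀ᶠ B in nhds R, Accretive B := by
  have hc : Continuous fun q : Matrix ι ι ℝ × (ι → ℝ) => q.2 ⬝ᵥ q.1 *ᵥ q.2 := by fun_prop
  have h1 : ∀ᶠ B in nhds R, ∀ x ∈ Metric.sphere (0 : ι → ℝ) 1, 0 < x ⬝ᵥ B *ᵥ x := by
    refine (isCompact_sphere (0 : ι → ℝ) 1).eventually_forall_of_forall_eventually ?_
    intro x hx
    have hx0 : x ≠ 0 := by rintro rfl; simp at hx
    exact hc.continuousAt.eventually (lt_mem_nhds (hR x hx0))
  filter_upwards [h1] with B hB x hx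
  have hn : 0 < ‖x‖ := norm_pos_iff.mpr hx
  have := hB (‖x‖⁻¹ • x) (by simp [norm_smul, hn.ne'])
  rw [mulVec_smul, dotProduct_smul, smul_dotProduct] at this
  have h2 : 0 < ‖x‖⁻¹ := by positivity
  simp only [smul_eq_mul] at this
  exact pos_of_mul_pos_right (pos_of_mul_pos_right this h2.le) h2.le

/-! ### Principal square roots: spectrum, uniqueness, existence -/

section Sqrt

variable {ι : Type*} [Fintype ι] [DecidableEq ι]

/-- For an eigenvector `x + iy` with eigenvalue `z`, the cross terms cancel when the forms at `x`
and `y` are added, leaving `Re z (|x|² + |y|²)`. -/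
theorem Accretive.re_pos {B : Matrix ι ι ℝ} (hB : Accretive B) :
    ∀ z ∈ spectrum ℂ (B.map (algebraMap ℝ ℂ)), 0 < z.re := by
  intro z hz
  rw [← Matrix.spectrum_toLin', ← Module.End.hasEigenvalue_iff_mem_spectrum] at hz
  obtain ⟨w, hw⟩ := hz.exists_hasEigenvector
  have h1 : B.map (algebraMap ℝ ℂ) *ᵥ w = z • w := by
    have := hw.apply_eq_smul; rwa [Matrix.toLin'_apply] at this
  have hw0 := hw.2
  set x : ι → ℝ := fun i => (w i).re
  set y : ι → ℝ := fun i => (w i).im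
  have hre : B *ᵥ x = z.re • x - z.im • y := by
    ext i
    have := congrArg Complex.re (congrFun h1 i)
    simpa [mulVec, dotProduct, x, y] using this
  have him : B *ᵥ y = z.re • y + z.im • x := by
    ext i
    have := congrArg Complex.im (congrFun h1 i)
    simpa [mulVec, dotProduct, x, y] using this
  have hs : x ⬝ᵥ B *ᵥ x + y ⬝ᵥ B *ᵥ y = z.re * (x ⬝ᵥ x + y ⬝ᵥ y) := by
    rw [hre, him]
    simp only [dotProduct_sub, dotProduct_add, dotProduct_smul, smul_eq_mul, dotProduct_comm y x]
    ring
  have hnn : ∀ v : ι → ℝ, 0 ≤ v ⬝ᵥ v := fun v => Finset.sum_nonneg fun i _ => mul_self_nonneg _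
  have hB' : ∀ v : ι → ℝ, 0 ≤ v ⬝ᵥ B *ᵥ v := fun v => by
    by_cases hv : v = 0
    · simp [hv]
    · exact (hB v hv).le
  have hpos : 0 < x ⬝ᵥ B *ᵥ x + y ⬝ᵥ B *ᵥ y := by
    by_cases hx : x = 0
    · have hy : y ≠ 0 := by
        rintro hy
        apply hw0
        ext i
        exact Complex.ext (congrFun hx i) (congrFun hy i)
      exact add_pos_of_nonneg_of_pos (hB' x) (hB y hy)
    · exact add_pos_of_pos_of_nonneg (hB x hx) (hB' y)
  rw [hs] at hpos
  exact pos_of_mul_pos_left hpos (add_nonneg (hnn x) (hnn y))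

/-- Over `ℂ`, `X` intertwines `R` with `-T`, hence also `p(R)` with `p(-T)` for every polynomial
`p`. For `p` the characteristic polynomial of `R`, `p(R) = 0` by Cayley-Hamilton, while `p(-T)` is
invertible because the spectra of `R` and `-T` lie in opposite open half planes. -/
theorem eq_zero_of_mul_add_mul_eq_zero {R T X : Matrix ι ι ℝ}
    (hR : ∀ z ∈ spectrum ℂ (R.map (algebraMap ℝ ℂ)), 0 < z.re)
    (hT : ∀ z ∈ spectrum ℂ (T.map (algebraMap ℝ ℂ)), 0 < z.re)
    (h : R * X + X * T = 0) : X = 0 := by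
  -- The spectral mapping theorem used below needs a nonempty spectrum.
  rcases isEmpty_or_nonempty ι with he | hne
  · ext i; exact he.elim i
  set r := R.map (algebraMap ℝ ℂ)
  set t := T.map (algebraMap ℝ ℂ)
  set x := X.map (algebraMap ℝ ℂ)
  have hx : r * x = x * (-t) := by
    have := congrArg (fun M : Matrix ι ι ℝ => M.map (algebraMap ℝ ℂ)) h
    simp only [Matrix.map_add _ (map_add _), Matrix.map_mul, Matrix.map_zero _ (map_zero _)] at this
    rw [mul_neg]
    exact eq_neg_of_add_eq_zero_left this
  have hsc : SemiconjBy x (-t) r := hx.symm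
  have hp : ∀ p : Polynomial ℂ, SemiconjBy x (Polynomial.aeval (-t) p) (Polynomial.aeval r p) := by
    intro p
    induction p using Polynomial.induction_on' with
    | add p q hp hq => simpa using hp.add_right hq
    | monomial k a =>
      simp only [Polynomial.aeval_monomial]
      exact (show SemiconjBy x (algebraMap ℂ _ a) (algebraMap ℂ _ a) from
        (Algebra.commutes a x).symm).mul_right (hsc.pow_right k)
  have h0 : x * Polynomial.aeval (-t) r.charpoly = 0 := by
    have := (hp r.charpoly).eq
    rw [Matrix.aeval_self_charpoly, zero_mul] at this
    exact this
  have hu : IsUnit (Polynomial.aeval (-t) r.charpoly) := by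
    rw [← spectrum.zero_notMem_iff ℂ]
    intro hz
    rw [spectrum.map_polynomial_aeval_of_nonempty _ _
      (spectrum.nonempty_of_isAlgClosed_of_finiteDimensional ℂ _)] at hz
    obtain ⟨μ, hμ, hμ0⟩ := hz
    have h1 : 0 < μ.re := by
      apply hR
      rw [Matrix.mem_spectrum_iff_isRoot_charpoly]
      exact hμ0
    have h2 : -μ ∈ spectrum ℂ t := by
      rw [← spectrum.neg_eq] at hμ
      simpa using hμ
    have := hT _ h2
    simp at this
    linarith
  have hx0 : x = 0 := by simpa using (hu.mul_left_eq_zero).mp h0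
  ext i j
  have := congrFun (congrFun hx0 i) j
  simpa [x] using this

/-- The difference of two roots solves a homogeneous Sylvester equation: `R(R - T) + (R - T)T = R² -
T² = 0`. -/
theorem IsPrincipalSqrt.unique {M R T : Matrix ι ι ℝ} (hR : IsPrincipalSqrt M R)
    (hT : IsPrincipalSqrt M T) : R = T := by
  refine sub_eq_zero.mp (eq_zero_of_mul_add_mul_eq_zero hR.2 hT.2 ?_)
  rw [mul_sub, sub_mul, hR.1, hT.1]
  abel

theorem IsPrincipalSqrt.sqrtm_eq {M R : Matrix ι ι ℝ} (hR : IsPrincipalSqrt M R) :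
    sqrtm M = R := by
  have h : ∃ R, IsPrincipalSqrt M R := ⟨R, hR⟩
  rw [sqrtm, dif_pos h]
  exact h.choose_spec.unique hR

theorem Accretive.isPrincipalSqrt {R : Matrix ι ι ℝ} (hR : Accretive R) :
    IsPrincipalSqrt (R * R) R := ⟨rfl, hR.re_pos⟩

open scoped MatrixOrder Matrix.Norms.L2Operator in
theorem exists_posDef_mul_self {A : Matrix ι ι ℝ} (hA : A.PosDef) :
    ∃ R : Matrix ι ι ℝ, R.PosDef ∧ R * R = A := by
  have h0 : 0 ≤ A := Matrix.nonneg_iff_posSemidef.mpr hA.posSemidef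
  have hs : CFC.sqrt A * CFC.sqrt A = A := CFC.sqrt_mul_sqrt_self A h0
  refine ⟨CFC.sqrt A, ?_, hs⟩
  have h1 : (CFC.sqrt A).PosSemidef := Matrix.nonneg_iff_posSemidef.mp (CFC.sqrt_nonneg A)
  rw [h1.posDef_iff_isUnit]
  have := hA.isUnit
  rw [← hs] at this
  exact isUnit_of_mul_isUnit_left this

theorem posDef_sqrtm {A : Matrix ι ι ℝ} (hA : A.PosDef) : (sqrtm A).PosDef := by
  obtain ⟨R, hR, rfl⟩ := exists_posDef_mul_self hA
  rwa [hR.accretive.isPrincipalSqrt.sqrtm_eq]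

theorem sqrtm_mul_sqrtm {A : Matrix ι ι ℝ} (hA : A.PosDef) : sqrtm A * sqrtm A = A := by
  obtain ⟨R, hR, rfl⟩ := exists_posDef_mul_self hA
  rw [hR.accretive.isPrincipalSqrt.sqrtm_eq]

end Sqrt

/-- Local inverse of the squaring map of a finite-dimensional normed algebra. -/
theorem exists_local_sqrt {E : Type*} [NormedRing E] [NormedAlgebra ℝ E] [FiniteDimensional ℝ E]
    (r : E) (hr : ∀ x, r * x + x * r = 0 → x = 0) :
    ∃ g : E → E, g (r * r) = r ∧ DifferentiableAt ℝ g (r * r) ∧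
      ∀ᶠ m in nhds (r * r), g m * g m = m := by
  have : CompleteSpace E := FiniteDimensional.complete ℝ E
  -- `x ↦ rx + xr` is the derivative of squaring at `r`; being injective in finite dimension, it is
  -- invertible.
  let L : E →ₗ[ℝ] E := LinearMap.mulLeft ℝ r + LinearMap.mulRight ℝ r
  have hL : Function.Injective L := by
    rw [injective_iff_map_eq_zero]
    intro x hx
    exact hr x (by simpa [L] using hx)
  let e : E ≃L[ℝ] E := (LinearEquiv.ofInjectiveEndo L hL).toContinuousLinearEquiv
  have hd : HasStrictFDerivAt (fun x : E => x * x) (e : E →L[ℝ] E) r := by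
    have h := (hasStrictFDerivAt_id (𝕜 := ℝ) r).mul' (hasStrictFDerivAt_id (𝕜 := ℝ) r)
    refine h.congr_fderiv ?_
    ext x
    simp [e, L]
  refine ⟨hd.localInverse _ _ _, hd.localInverse_apply_image, hd.to_localInverse.differentiableAt,
    hd.eventually_right_inverse⟩

/-! ### Smooth dependence of the root on all entries -/

section SqrtDiff

variable {ι : Type*} [Fintype ι] [DecidableEq ι]

attribute [local instance] Matrix.linftyOpNormedRing Matrix.linftyOpNormedAlgebra

/-- The local inverse of squaring at `A^{1/2}` is continuous with accretive value there, so it stays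
accretive nearby; uniqueness identifies it with `sqrtm`, which thereby inherits differentiability.
No symmetry of the nearby matrices is used. -/
theorem sqrtm_unvec_regular {A : Matrix ι ι ℝ} (hA : A.PosDef) :
    (∀ᶠ a in nhds (vec A), sqrtm (unvec a) * sqrtm (unvec a) = unvec a ∧
      Accretive (sqrtm (unvec a))) ∧
    (∀ i j, DifferentiableAt ℝ (fun a => sqrtm (unvec a) i j) (vec A)) ∧
    (∀ i j, DifferentiableAt ℝ (fun a => (sqrtm (unvec a))⁻¹ i j) (vec A)) := by
  set r := sqrtm A with hrdef
  have hr : r.PosDef := posDef_sqrtm hA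
  have hrr : r * r = A := sqrtm_mul_sqrtm hA
  obtain ⟨g, hg1, hg2, hg3⟩ := exists_local_sqrt r fun x hx =>
    eq_zero_of_mul_add_mul_eq_zero hr.accretive.re_pos hr.accretive.re_pos hx
  let U : (ι × ι → ℝ) →ₗ[ℝ] Matrix ι ι ℝ :=
    { toFun := unvec, map_add' := fun _ _ => rfl, map_smul' := fun _ _ => rfl }
  let Uc : (ι × ι → ℝ) →L[ℝ] Matrix ι ι ℝ := U.toContinuousLinearMap
  have hU0 : Uc (vec A) = r * r := by rw [hrr]; rfl
  have hcont : Filter.Tendsto Uc (nhds (vec A)) (nhds (r * r)) := by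
    rw [← hU0]; exact Uc.continuous.continuousAt
  have hacc : ∀ᶠ m in nhds (r * r), Accretive (g m) := by
    have h := hg2.continuousAt
    have h2 := eventually_accretive hr.accretive
    rw [← hg1] at h2
    exact h.eventually h2
  have hev : ∀ᶠ a in nhds (vec A), g (Uc a) * g (Uc a) = unvec a ∧ Accretive (g (Uc a)) :=
    hcont.eventually (hg3.and hacc)
  have heq : ∀ᶠ a in nhds (vec A), sqrtm (unvec a) = g (Uc a) := by
    filter_upwards [hev] with a ha
    rw [← ha.1]
    exact ha.2.isPrincipalSqrt.sqrtm_eq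
  have hd : DifferentiableAt ℝ (fun a => g (Uc a)) (vec A) := by
    refine DifferentiableAt.comp (vec A) (g := g) ?_ Uc.differentiableAt
    rw [hU0]; exact hg2
  have hd' : DifferentiableAt ℝ (fun a => (g (Uc a))⁻¹) (vec A) := by
    have hu : IsUnit (g (Uc (vec A))) := by rw [hU0, hg1]; exact hr.isUnit
    simp_rw [nonsing_inv_eq_ringInverse]
    exact DifferentiableAt.comp (vec A) (differentiableAt_inverse hu) hd
  have hentry : ∀ (f : (ι × ι → ℝ) → Matrix ι ι ℝ), DifferentiableAt ℝ f (vec A) →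
      ∀ i j, DifferentiableAt ℝ (fun a => f a i j) (vec A) := by
    intro f hf i j
    let ev : Matrix ι ι ℝ →ₗ[ℝ] ℝ := Matrix.entryLinearMap ℝ ℝ i j
    exact (ev.toContinuousLinearMap.differentiableAt).comp (vec A) hf
  refine ⟨?_, fun i j => ?_, fun i j => ?_⟩
  · filter_upwards [hev, heq] with a h1 h2
    rw [h2]; exact h1
  · refine (hentry _ hd i j).congr_of_eventuallyEq ?_
    filter_upwards [heq] with a h2
    rw [h2]
  · refine (hentry _ hd' i j).congr_of_eventuallyEq ?_
    filter_upwards [heq] with a h2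
    rw [h2]

end SqrtDiff

/-! ### Canonical form: cluster means and within-cluster deviations -/

section Block

variable {K : ℕ} (n : Fin K → ℕ)

/-- The `n × K` matrix whose `k`-th column is `v_{n_k}` on the `k`-th cluster. -/
noncomputable def clusterMat : Matrix (Idx n) (Fin K) ℝ :=
  Matrix.of fun x k => if x.1 = k then 1 / √(n k : ℝ) else 0

/-- The projection onto the vectors with vanishing cluster means. -/
noncomputable def withinProj : Matrix (Idx n) (Idx n) ℝ := 1 - clusterMat n * (clusterMat n)ᵀ

/-- The matrix acting as `M` on cluster means and as `d k` on within-cluster deviations. -/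
noncomputable def blockMat (M : Matrix (Fin K) (Fin K) ℝ) (d : Fin K → ℝ) :
    Matrix (Idx n) (Idx n) ℝ :=
  clusterMat n * M * (clusterMat n)ᵀ + diagonal (fun x => d x.1) * withinProj n

variable {n}

theorem sum_idx_ite (k : Fin K) (f : Idx n → ℝ) :
    (∑ x : Idx n, if x.1 = k then f x else 0) = ∑ i : Fin (n k), f ⟨k, i⟩ := by
  rw [Fintype.sum_sigma]
  rw [Finset.sum_eq_single k]
  · simp
  · intro b _ hb
    simp [hb]
  · simp

theorem one_div_sqrt_mul_self (k : Fin K) :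
    1 / √(n k : ℝ) * (1 / √(n k : ℝ)) = (n k : ℝ)⁻¹ := by
  have : (0 : ℝ) ≤ n k := by positivity
  rw [div_mul_div_comm, Real.mul_self_sqrt this, one_mul, one_div]

theorem natCast_pos_of_two_le (hn : ∀ k, 2 ≤ n k) (k : Fin K) : (0 : ℝ) < n k := by
  have := hn k
  exact_mod_cast (by omega : 0 < n k)

theorem natCast_sub_one_pos (hn : ∀ k, 2 ≤ n k) (k : Fin K) : (0 : ℝ) < (n k : ℝ) - 1 := by
  have : (2 : ℝ) ≤ n k := by exact_mod_cast hn k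
  linarith

theorem clusterMat_transpose_mul_self (hn : ∀ k, 2 ≤ n k) :
    (clusterMat n)ᵀ * clusterMat n = 1 := by
  ext k l
  have h0 := (natCast_pos_of_two_le hn k).ne'
  simp only [mul_apply, transpose_apply, clusterMat, of_apply, ite_mul, zero_mul, sum_idx_ite]
  by_cases h : k = l
  · subst h
    simp only [if_true, one_div_sqrt_mul_self, Finset.sum_const, Finset.card_univ,
      Fintype.card_fin, nsmul_eq_mul, one_apply_eq]
    field_simp
  · simp [h]

theorem clusterMat_mul_transpose_apply (x y : Idx n) :
    (clusterMat n * (clusterMat n)ᵀ) x y = if x.1 = y.1 then (n x.1 : ℝ)⁻¹ else 0 := by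
  simp only [mul_apply, transpose_apply, clusterMat, of_apply, ite_mul, zero_mul,
    Finset.sum_ite_eq, Finset.mem_univ, if_true, mul_ite, mul_zero]
  by_cases h : x.1 = y.1
  · rw [if_pos h, if_pos h, one_div_sqrt_mul_self, h]
  · rw [if_neg h, if_neg h]

theorem withinProj_apply (x y : Idx n) :
    withinProj n x y = (if x = y then 1 else 0) - if x.1 = y.1 then (n x.1 : ℝ)⁻¹ else 0 := by
  rw [withinProj, Matrix.sub_apply, clusterMat_mul_transpose_apply, one_apply]

theorem withinProj_transpose : (withinProj n)ᵀ = withinProj n := by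
  simp [withinProj, transpose_sub, transpose_mul]

theorem withinProj_mul_clusterMat (hn : ∀ k, 2 ≤ n k) : withinProj n * clusterMat n = 0 := by
  rw [withinProj, Matrix.sub_mul, Matrix.mul_assoc, clusterMat_transpose_mul_self hn]
  simp

theorem clusterMat_transpose_mul_withinProj (hn : ∀ k, 2 ≤ n k) :
    (clusterMat n)ᵀ * withinProj n = 0 := by
  rw [← withinProj_transpose, ← transpose_mul, withinProj_mul_clusterMat hn, transpose_zero]

theorem withinProj_mul_self (hn : ∀ k, 2 ≤ n k) :
    withinProj n * withinProj n = withinProj n := by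
  nth_rewrite 2 [withinProj]
  rw [Matrix.mul_sub, ← Matrix.mul_assoc, withinProj_mul_clusterMat hn]
  simp

theorem diagonal_mul_clusterMat (d : Fin K → ℝ) :
    diagonal (fun x : Idx n => d x.1) * clusterMat n = clusterMat n * diagonal d := by
  ext x k
  simp only [mul_diagonal, diagonal_mul, clusterMat, of_apply]
  by_cases h : x.1 = k
  · rw [h]; ring
  · simp [h]

theorem clusterMat_transpose_mul_diagonal (d : Fin K → ℝ) :
    (clusterMat n)ᵀ * diagonal (fun x : Idx n => d x.1) = diagonal d * (clusterMat n)ᵀ := by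
  rw [← diagonal_transpose, ← transpose_mul, diagonal_mul_clusterMat, transpose_mul,
    diagonal_transpose]

theorem withinProj_mul_diagonal (d : Fin K → ℝ) :
    withinProj n * diagonal (fun x => d x.1) = diagonal (fun x => d x.1) * withinProj n := by
  rw [withinProj, Matrix.sub_mul, Matrix.mul_sub, ← Matrix.mul_assoc, diagonal_mul_clusterMat,
    Matrix.mul_assoc, clusterMat_transpose_mul_diagonal, Matrix.mul_assoc, Matrix.one_mul,
    Matrix.mul_one]

theorem clusterMat_transpose_mul_blockMat (hn : ∀ k, 2 ≤ n k) (M : Matrix (Fin K) (Fin K) ℝ)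
    (d : Fin K → ℝ) : (clusterMat n)ᵀ * blockMat n M d = M * (clusterMat n)ᵀ := by
  rw [blockMat, Matrix.mul_add, ← Matrix.mul_assoc _ (diagonal _),
    clusterMat_transpose_mul_diagonal, Matrix.mul_assoc (diagonal d),
    clusterMat_transpose_mul_withinProj hn, ← Matrix.mul_assoc,
    ← Matrix.mul_assoc, clusterMat_transpose_mul_self hn]
  simp

theorem withinProj_mul_blockMat (hn : ∀ k, 2 ≤ n k) (M : Matrix (Fin K) (Fin K) ℝ)
    (d : Fin K → ℝ) :
    withinProj n * blockMat n M d = diagonal (fun x => d x.1) * withinProj n := by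
  rw [blockMat, Matrix.mul_add, ← Matrix.mul_assoc, ← Matrix.mul_assoc, withinProj_mul_clusterMat hn,
    ← Matrix.mul_assoc, withinProj_mul_diagonal, Matrix.mul_assoc _ (withinProj n),
    withinProj_mul_self hn]
  simp

/-- The ranges of `V` and `P` are complementary and cluster-wise scalars commute with `P`, so the
two components never mix. -/
theorem blockMat_mul_blockMat (hn : ∀ k, 2 ≤ n k) (M M' : Matrix (Fin K) (Fin K) ℝ)
    (d d' : Fin K → ℝ) :
    blockMat n M d * blockMat n M' d' = blockMat n (M * M') (d * d') := by
  nth_rewrite 1 [blockMat]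
  rw [Matrix.add_mul, Matrix.mul_assoc _ (clusterMat n)ᵀ, clusterMat_transpose_mul_blockMat hn,
    Matrix.mul_assoc _ (withinProj n), withinProj_mul_blockMat hn, ← Matrix.mul_assoc (diagonal _),
    diagonal_mul_diagonal, blockMat]
  simp only [Matrix.mul_assoc, Pi.mul_apply]

theorem blockMat_one_one : blockMat n 1 1 = 1 := by
  simp [blockMat, withinProj]

/-- Inside a cluster the entries are `M_{kk}/n_k + λ_k(1 - 1/n_k) = 1` on the diagonal and `(M_{kk}
- λ_k)/n_k = ρ_{kk}` off it; between clusters only `V M V'` contributes. `M` need not be symmetric,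
so the form is available around `A`. -/
theorem corrOfA_eq_blockMat (hn : ∀ k, 2 ≤ n k) (M : Matrix (Fin K) (Fin K) ℝ) :
    corrOfA n M = blockMat n M (lam n M) := by
  ext x y
  have h1 := (natCast_pos_of_two_le hn x.1)
  have h1' := (natCast_pos_of_two_le hn y.1)
  have h2 := (natCast_sub_one_pos hn x.1).ne'
  have hs : √((n x.1 : ℝ) * n y.1) = √(n x.1 : ℝ) * √(n y.1 : ℝ) := Real.sqrt_mul h1.le _
  have h3 : √(n x.1 : ℝ) ≠ 0 := by positivity
  have h4 : √(n y.1 : ℝ) ≠ 0 := by positivity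
  have hV : (clusterMat n * M * (clusterMat n)ᵀ) x y =
      1 / √(n x.1 : ℝ) * M x.1 y.1 * (1 / √(n y.1 : ℝ)) := by
    simp [mul_apply, clusterMat]
  rw [blockMat, Matrix.add_apply, hV, diagonal_mul, withinProj_apply, corrOfA, blockCorr, of_apply,
    rhoOfA, of_apply, lam]
  by_cases hxy : x = y
  · subst hxy
    simp only [if_true]
    rw [mul_right_comm, one_div_sqrt_mul_self]
    field_simp
    ring
  · by_cases hk : x.1 = y.1
    · rw [if_neg hxy, if_pos hk, if_neg hxy, if_pos hk, ← hk, mul_right_comm, one_div_sqrt_mul_self]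
      field_simp
      ring
    · rw [if_neg hxy, if_neg hk, if_neg hxy, if_neg hk, hs]
      field_simp
      ring

/-- The quadratic form splits into that of `M` at the cluster means and a weighted sum of squared
deviations. If the means vanish, the vector equals its own deviations. -/
theorem accretive_blockMat (hn : ∀ k, 2 ≤ n k) {M : Matrix (Fin K) (Fin K) ℝ} {d : Fin K → ℝ}
    (hM : Accretive M) (hd : ∀ k, 0 < d k) : Accretive (blockMat n M d) := by
  intro x hx
  set y := (clusterMat n)ᵀ *ᵥ x
  set w := withinProj n *ᵥ x
  have hq : diagonal (fun x => d x.1) * withinProj n =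
      (withinProj n)ᵀ * (diagonal (fun x => d x.1) * withinProj n) := by
    rw [withinProj_transpose, ← Matrix.mul_assoc, withinProj_mul_diagonal, Matrix.mul_assoc,
      withinProj_mul_self hn]
  have h : x ⬝ᵥ blockMat n M d *ᵥ x = y ⬝ᵥ M *ᵥ y + ∑ i, d i.1 * (w i * w i) := by
    rw [blockMat, add_mulVec, dotProduct_add]
    congr 1
    · rw [Matrix.mul_assoc, ← mulVec_mulVec, dotProduct_mulVec, ← mulVec_transpose, ← mulVec_mulVec]
    · rw [hq, ← mulVec_mulVec, dotProduct_mulVec, ← mulVec_transpose, transpose_transpose,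
        ← mulVec_mulVec, dotProduct]
      refine Finset.sum_congr rfl fun i _ => ?_
      rw [mulVec_diagonal]
      simp only [w]
      ring
  rw [h]
  have hw : 0 ≤ ∑ i, d i.1 * (w i * w i) :=
    Finset.sum_nonneg fun i _ => mul_nonneg (hd _).le (mul_self_nonneg _)
  by_cases hy : y = 0
  · have hxw : x = w := by
      have : x - w = clusterMat n *ᵥ y := by
        simp only [w, y, withinProj, sub_mulVec, one_mulVec, mulVec_mulVec]
        abel
      rw [hy, mulVec_zero] at this
      exact sub_eq_zero.mp this
    obtain ⟨i, hi⟩ := Function.ne_iff.mp hx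
    have : 0 < ∑ i, d i.1 * (w i * w i) := by
      refine Finset.sum_pos' (fun i _ => mul_nonneg (hd _).le (mul_self_nonneg _)) ⟨i, Finset.mem_univ _, ?_⟩
      rw [← hxw]
      exact mul_pos (hd _) (mul_self_pos.mpr hi)
    simpa [hy] using this
  · exact add_pos_of_pos_of_nonneg (hM y hy) hw

theorem corrOfA_canonA (hn : ∀ k, 2 ≤ n k) (ρ : Matrix (Fin K) (Fin K) ℝ) :
    corrOfA n (canonA n ρ) = blockCorr n ρ := by
  rw [corrOfA, rhoOfA_canonA n hn]

/-- `A = V'CV` is a compression of `C` by the injective matrix `V`. -/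
theorem posDef_of_posDef_corrOfA (hn : ∀ k, 2 ≤ n k) {A : Matrix (Fin K) (Fin K) ℝ}
    (h : (corrOfA n A).PosDef) : A.PosDef := by
  rw [corrOfA_eq_blockMat hn] at h
  have h1 : A = (clusterMat n)ᴴ * blockMat n A (lam n A) * clusterMat n := by
    rw [conjTranspose_eq_transpose_of_trivial, clusterMat_transpose_mul_blockMat hn,
      Matrix.mul_assoc, clusterMat_transpose_mul_self hn, mul_one]
  rw [h1]
  refine h.conjTranspose_mul_mul_same ?_
  intro x y hxy
  have := congrArg (fun v => (clusterMat n)ᵀ *ᵥ v) hxy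
  simpa [mulVec_mulVec, clusterMat_transpose_mul_self hn] using this

/-- `λ_k` is an eigenvalue of `C`: the deviation part of a coordinate vector of cluster `k` is an
eigenvector, nonzero since `n_k ≥ 2`. -/
theorem lam_pos_of_posDef_corrOfA (hn : ∀ k, 2 ≤ n k) {A : Matrix (Fin K) (Fin K) ℝ}
    (h : (corrOfA n A).PosDef) (k : Fin K) : 0 < lam n A k := by
  rw [corrOfA_eq_blockMat hn] at h
  have h0 : 0 < n k := by have := hn k; omega
  let x0 : Idx n := ⟨k, ⟨0, h0⟩⟩
  set w := withinProj n *ᵥ Pi.single x0 1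
  have hw0 : w x0 = 1 - (n k : ℝ)⁻¹ := by
    simp [w, withinProj_apply, x0]
  have hpos : 0 < w x0 := by
    rw [hw0, sub_pos]
    have : (1 : ℝ) < n k := by linarith [natCast_sub_one_pos hn k]
    exact inv_lt_one_of_one_lt₀ this
  have hw : w ≠ 0 := fun e => by simp [e] at hpos
  have hx := h.accretive w hw
  have hwk : ∀ x : Idx n, x.1 ≠ k → w x = 0 := by
    intro x hx
    have : x ≠ x0 := fun e => hx (by rw [e])
    simp [w, withinProj_apply, x0, hx, this]
  have hm : blockMat n A (lam n A) *ᵥ w = lam n A k • w := by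
    have hww : withinProj n *ᵥ w = w := by
      simp only [w, mulVec_mulVec, withinProj_mul_self hn]
    have hcw : (clusterMat n)ᵀ *ᵥ w = 0 := by
      simp only [w, mulVec_mulVec, clusterMat_transpose_mul_withinProj hn, zero_mulVec]
    rw [blockMat, add_mulVec, ← mulVec_mulVec, hcw, mulVec_zero, zero_add, ← mulVec_mulVec, hww]
    ext x
    rw [mulVec_diagonal, Pi.smul_apply, smul_eq_mul]
    by_cases hxk : x.1 = k
    · rw [hxk]
    · rw [hwk x hxk]; simp
  rw [hm, dotProduct_smul, smul_eq_mul] at hx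
  exact pos_of_mul_pos_left hx (Finset.sum_nonneg fun i _ => mul_self_nonneg _)

theorem sqrtm_blockMat (hn : ∀ k, 2 ≤ n k) {M R : Matrix (Fin K) (Fin K) ℝ} {d : Fin K → ℝ}
    (hM : R * R = M) (hR : Accretive R) (hd : ∀ k, 0 < d k) :
    sqrtm (blockMat n M d) = blockMat n R fun k => √(d k) := by
  have h := (accretive_blockMat hn hR (d := fun k => √(d k))
    fun k => Real.sqrt_pos.mpr (hd k)).isPrincipalSqrt
  rw [blockMat_mul_blockMat hn, hM] at h
  rw [← h.sqrtm_eq]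
  congr 2
  ext k
  simp [Real.mul_self_sqrt (hd k).le]

theorem Accretive.isUnit {ι : Type*} [Fintype ι] [DecidableEq ι] {R : Matrix ι ι ℝ}
    (hR : Accretive R) : IsUnit R := by
  rw [← mulVec_injective_iff_isUnit, ← coe_mulVecLin, injective_iff_map_eq_zero]
  intro x hx
  by_contra h
  have := hR x h
  rw [mulVecLin_apply] at hx
  simp [hx] at this

theorem inv_blockMat (hn : ∀ k, 2 ≤ n k) {R : Matrix (Fin K) (Fin K) ℝ} {d : Fin K → ℝ}
    (hR : IsUnit R) (hd : ∀ k, d k ≠ 0) :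
    (blockMat n R d)⁻¹ = blockMat n R⁻¹ d⁻¹ := by
  refine inv_eq_right_inv ?_
  rw [blockMat_mul_blockMat hn, mul_nonsing_inv _ ((isUnit_iff_isUnit_det _).mp hR),
    ← blockMat_one_one]
  congr 1
  ext k
  simp [hd k]

end Block

/-! ### Derivatives of matrix products and determinants -/

section Calculus

variable {ι : Type*} [Fintype ι] [DecidableEq ι]

theorem hasDerivAt_mul_apply {l m o : Type*} [Fintype m]
    {F : ℝ → Matrix l m ℝ} {G : ℝ → Matrix m o ℝ} {F' : Matrix l m ℝ} {G' : Matrix m o ℝ} {t : ℝ}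
    (hF : ∀ i j, HasDerivAt (fun s => F s i j) (F' i j) t)
    (hG : ∀ i j, HasDerivAt (fun s => G s i j) (G' i j) t) (i : l) (j : o) :
    HasDerivAt (fun s => (F s * G s) i j) ((F' * G t + F t * G') i j) t := by
  have h : HasDerivAt (fun s => ∑ k, F s i k * G s k j)
      (∑ k, (F' i k * G t k j + F t i k * G' k j)) t :=
    HasDerivAt.fun_sum fun k _ => (hF i k).mul (hG k j)
  rw [Finset.sum_add_distrib] at h
  exact h

/-- Jacobi's formula. After factoring out `det C`, the remaining determinant is a polynomial in `t`
with linear coefficient `tr(C⁻¹G)` and remainder divisible by `t²`. -/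
theorem hasDerivAt_det_add_smul {C : Matrix ι ι ℝ} (hC : IsUnit C) (G : Matrix ι ι ℝ) :
    HasDerivAt (fun t : ℝ => (C + t • G).det) (C.det * (C⁻¹ * G).trace) 0 := by
  have h1 : ∀ t : ℝ, (C + t • G).det = C.det * (1 + (C⁻¹ * G).trace * t +
      (Polynomial.divX (Polynomial.divX (det (1 + (Polynomial.X : Polynomial ℝ) •
        (C⁻¹ * G).map Polynomial.C)))).eval t * t ^ 2) := by
    intro t
    rw [← det_one_add_smul, ← det_mul, Matrix.mul_add, Matrix.mul_one, Matrix.mul_smul, ← Matrix.mul_assoc,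
      mul_nonsing_inv _ ((isUnit_iff_isUnit_det _).mp hC), Matrix.one_mul]
  simp_rw [h1]
  set q := Polynomial.divX (Polynomial.divX (det (1 + (Polynomial.X : Polynomial ℝ) • (C⁻¹ * G).map Polynomial.C)))
  have h2 : HasDerivAt (fun t : ℝ => 1 + (C⁻¹ * G).trace * t + q.eval t * t ^ 2)
      ((C⁻¹ * G).trace) 0 := by
    have h3 := (((hasDerivAt_id (0 : ℝ)).const_mul (C⁻¹ * G).trace).const_add 1).add
      ((q.hasDerivAt 0).mul (hasDerivAt_pow 2 (0 : ℝ)))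
    refine (h3.congr_deriv ?_)
    simp
  exact h2.const_mul _

theorem differentiableAt_det {E : Type*} [NormedAddCommGroup E] [NormedSpace ℝ E]
    {F : E → Matrix ι ι ℝ} {a : E} (hF : ∀ i j, DifferentiableAt ℝ (fun x => F x i j) a) :
    DifferentiableAt ℝ (fun x => (F x).det) a := by
  simp_rw [det_apply]
  refine DifferentiableAt.fun_sum fun σ _ => ?_
  refine DifferentiableAt.const_smul ?_ _
  exact (HasFDerivAt.finsetProd fun i _ => (hF (σ i) i).hasFDerivAt).differentiableAt

end Calculus

/-! ### Logarithmic derivative of the `t` density -/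

section TDensity

theorem tStdPDF_pos {ν : ℝ} (hν : 2 < ν) (y : ℝ) : 0 < tStdPDF ν y := by
  have h1 : 0 < ν - 2 := by linarith
  have h2 : 0 < Real.Gamma ((ν + 1) / 2) := Real.Gamma_pos_of_pos (by linarith)
  have h3 : 0 < Real.Gamma (ν / 2) := Real.Gamma_pos_of_pos (by linarith)
  unfold tStdPDF
  have := Real.pi_pos
  positivity

theorem hasDerivAt_log_tStdPDF {ν : ℝ} (hν : 2 < ν) (y : ℝ) :
    HasDerivAt (fun u => Real.log (tStdPDF ν u)) (-((ν + 1) / (ν - 2 + y ^ 2) * y)) y := by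
  have h1 : 0 < ν - 2 := by linarith
  have h2 : 0 < Real.Gamma ((ν + 1) / 2) := Real.Gamma_pos_of_pos (by linarith)
  have h3 : 0 < Real.Gamma (ν / 2) := Real.Gamma_pos_of_pos (by linarith)
  have hpi := Real.pi_pos
  have hb : ∀ u : ℝ, 0 < 1 + u ^ 2 / (ν - 2) := fun u => by positivity
  have he : (fun u => Real.log (tStdPDF ν u)) = fun u =>
      Real.log (Real.Gamma ((ν + 1) / 2) / Real.Gamma (ν / 2) *
        ((ν - 2) * Real.pi) ^ (-(1 / 2) : ℝ)) + -((ν + 1) / 2) * Real.log (1 + u ^ 2 / (ν - 2)) := by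
    ext u
    have := hb u
    rw [tStdPDF, Real.log_mul (by positivity) (by positivity), Real.log_rpow this]
  rw [he]
  have h4 : HasDerivAt (fun u : ℝ => 1 + u ^ 2 / (ν - 2)) (2 * y / (ν - 2)) y := by
    simpa using ((hasDerivAt_pow 2 y).div_const (ν - 2)).const_add 1
  have h5 := ((h4.log (hb y).ne').const_mul (-((ν + 1) / 2))).const_add
    (Real.log (Real.Gamma ((ν + 1) / 2) / Real.Gamma (ν / 2) *
        ((ν - 2) * Real.pi) ^ (-(1 / 2) : ℝ)))
  refine h5.congr_deriv ?_
  have h6 : ν - 2 + y ^ 2 ≠ 0 := by positivity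
  have h7 : 1 + y ^ 2 / (ν - 2) = (ν - 2 + y ^ 2) / (ν - 2) := by field_simp
  rw [h7]
  field_simp

end TDensity

/-! ### The matrix `Ω_A` and the Sylvester equation -/

section Kron

variable {ι : Type*} [Fintype ι] [DecidableEq ι]

theorem kronPlus_one_mulVec_vec {R : Matrix ι ι ℝ} (hR : Rᵀ = R) (X : Matrix ι ι ℝ) :
    kronPlus R 1 *ᵥ vec X = vec (R * X + X * R) := by
  rw [kronPlus, add_mulVec, kronecker_mulVec_vec, kronecker_mulVec_vec, hR]
  simp [vec_add, add_comm]

theorem posDef_kronPlus_one {R : Matrix ι ι ℝ} (hR : R.PosDef) : (kronPlus R 1).PosDef :=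
  (hR.kronecker PosDef.one).add (PosDef.one.kronecker hR)

variable {K : ℕ} {A : Matrix (Fin K) (Fin K) ℝ}

/-- `Ω_A` is a product of two symmetric matrices that commute. -/
theorem OmegaA_transpose (hA : A.PosDef) : (OmegaA A)ᵀ = OmegaA A := by
  have hR := posDef_sqrtm hA
  have hRt : (sqrtm A)ᵀ = sqrtm A := by simpa using hR.isHermitian.eq
  have hk := posDef_kronPlus_one hR
  have hkt : (kronPlus (sqrtm A) 1)ᵀ = kronPlus (sqrtm A) 1 := by simpa using hk.isHermitian.eq
  have hdk := (isUnit_iff_isUnit_det _).mp hk.isUnit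
  have hdR := (isUnit_iff_isUnit_det _).mp hR.isUnit
  have hc : ((1 : Matrix (Fin K) (Fin K) ℝ) ⊗ₖ invSqrtm A) * kronPlus (sqrtm A) 1 =
      kronPlus (sqrtm A) 1 * ((1 : Matrix (Fin K) (Fin K) ℝ) ⊗ₖ invSqrtm A) := by
    simp only [kronPlus, Matrix.mul_add, Matrix.add_mul, ← mul_kronecker_mul, invSqrtm,
      Matrix.one_mul, Matrix.mul_one, mul_nonsing_inv _ hdR, nonsing_inv_mul _ hdR]
  rw [OmegaA, transpose_mul, transpose_nonsing_inv, hkt, ← kroneckerMap_transpose, transpose_one,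
    invSqrtm, transpose_nonsing_inv, hRt]
  change (kronPlus (sqrtm A) 1)⁻¹ * (1 ⊗ₖ invSqrtm A) = (1 ⊗ₖ invSqrtm A) * _
  calc _ = (kronPlus (sqrtm A) 1)⁻¹ * (((1 : Matrix (Fin K) (Fin K) ℝ) ⊗ₖ invSqrtm A) *
        kronPlus (sqrtm A) 1) * (kronPlus (sqrtm A) 1)⁻¹ := by
        rw [Matrix.mul_assoc, Matrix.mul_assoc _ (kronPlus _ _), mul_nonsing_inv _ hdk,
          Matrix.mul_one]
    _ = _ := by
        rw [hc, ← Matrix.mul_assoc, nonsing_inv_mul _ hdk, Matrix.one_mul]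

/-- The inverse of `A^{1/2} ⊕ I` solves the Sylvester equation, so `Ω_A` sends a direction `H` to
`A^{-1/2}` times the derivative of the root. -/
theorem OmegaA_mulVec_vec (hA : A.PosDef) (X : Matrix (Fin K) (Fin K) ℝ) :
    OmegaA A *ᵥ vec (sqrtm A * X + X * sqrtm A) = vec (invSqrtm A * X) := by
  have hR := posDef_sqrtm hA
  have hRt : (sqrtm A)ᵀ = sqrtm A := by simpa using hR.isHermitian.eq
  have hdk := (isUnit_iff_isUnit_det _).mp (posDef_kronPlus_one hR).isUnit
  rw [← kronPlus_one_mulVec_vec hRt, OmegaA, mulVec_mulVec, Matrix.mul_assoc,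
    nonsing_inv_mul _ hdk, Matrix.mul_one, kronecker_mulVec_vec]
  simp

end Kron

/-! ### Likelihood ingredients in canonical coordinates -/

section Canonical

variable {K : ℕ} {n : Fin K → ℕ}

theorem Y0_eq (z : Idx n → ℝ) : Y0 n z = (clusterMat n)ᵀ *ᵥ z := by
  ext k
  simp [Y0, unitVec, clusterMat, mulVec, dotProduct, sum_idx_ite]

theorem Frow_dotProduct (u : Idx n → ℝ) (k : Fin K) (i : Fin (n k)) :
    (Frow (n k) i ⬝ᵥ fun j => u ⟨k, j⟩) = (withinProj n *ᵥ u) ⟨k, i⟩ := by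
  have h : ∀ j, Frow (n k) i j = (if i = j then 1 else 0) - (n k : ℝ)⁻¹ := by
    intro j
    rw [Frow, single_one_vecMul, row_apply, Matrix.sub_apply, one_apply, vecMulVec_apply]
    simp only [unitVec]
    rw [one_div_sqrt_mul_self]
  have h2 : ∀ y : Idx n, withinProj n ⟨k, i⟩ y * u y =
      if y.1 = k then ((if (⟨k, i⟩ : Idx n) = y then 1 else 0) - (n k : ℝ)⁻¹) * u y else 0 := by
    intro y
    rw [withinProj_apply]
    by_cases hy : y.1 = k
    · simp [hy]
    · have : (⟨k, i⟩ : Idx n) ≠ y := fun e => hy (by rw [← e])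
      simp [hy, this, Ne.symm hy]
  simp only [mulVec, dotProduct, h2, sum_idx_ite, h]
  simp

theorem Svec_eq (ν : Idx n → ℝ) (A : Matrix (Fin K) (Fin K) ℝ) (u : Idx n → ℝ) (k : Fin K) :
    Svec n ν A u k = 1 / lam n A k - (∑ x : Idx n, if x.1 = k then
      weight ν u x * u x * (withinProj n *ᵥ u) x else 0) / (((n k : ℝ) - 1) * lam n A k) := by
  simp only [Svec, Frow_dotProduct, sum_idx_ite]

theorem trace_blockMat (hn : ∀ k, 2 ≤ n k) (M : Matrix (Fin K) (Fin K) ℝ) (d : Fin K → ℝ) :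
    (blockMat n M d).trace = M.trace + ∑ k, ((n k : ℝ) - 1) * d k := by
  rw [blockMat, trace_add, trace_mul_comm, ← Matrix.mul_assoc, clusterMat_transpose_mul_self hn,
    Matrix.one_mul]
  congr 1
  simp only [trace, diag_apply, diagonal_mul, withinProj_apply, if_true, Fintype.sum_sigma]
  refine Finset.sum_congr rfl fun k _ => ?_
  have := (natCast_pos_of_two_le hn k).ne'
  simp
  field_simp

theorem lam_add_smul (A H : Matrix (Fin K) (Fin K) ℝ) (t : ℝ) (k : Fin K) :
    lam n (A + t • H) k = lam n A k + t * (-(H k k) / ((n k : ℝ) - 1)) := by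
  simp [lam]
  ring

theorem blockMat_add_smul (A H : Matrix (Fin K) (Fin K) ℝ) (d e : Fin K → ℝ) (t : ℝ) :
    blockMat n (A + t • H) (fun k => d k + t * e k) = blockMat n A d + t • blockMat n H e := by
  have : diagonal (fun x : Idx n => d x.1 + t * e x.1) =
      diagonal (fun x : Idx n => d x.1) + t • diagonal (fun x : Idx n => e x.1) := by
    rw [← diagonal_smul, diagonal_add]; rfl
  simp only [blockMat, this, Matrix.mul_add, Matrix.add_mul, Matrix.mul_smul, Matrix.smul_mul,
    smul_add]
  abel

theorem corrOfA_add_smul (hn : ∀ k, 2 ≤ n k) (A H : Matrix (Fin K) (Fin K) ℝ) (t : ℝ) :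
    corrOfA n (A + t • H) =
      corrOfA n A + t • blockMat n H fun k => -(H k k) / ((n k : ℝ) - 1) := by
  rw [corrOfA_eq_blockMat hn, corrOfA_eq_blockMat hn, ← blockMat_add_smul]
  congr 1
  ext k
  exact lam_add_smul A H t k

theorem invSqrtm_corrOfA (hn : ∀ k, 2 ≤ n k) {M : Matrix (Fin K) (Fin K) ℝ}
    (h1 : sqrtm M * sqrtm M = M) (h2 : Accretive (sqrtm M)) (hl : ∀ k, 0 < lam n M k) :
    invSqrtm (corrOfA n M) = blockMat n (sqrtm M)⁻¹ fun k => (√(lam n M k))⁻¹ := by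
  rw [invSqrtm, corrOfA_eq_blockMat hn, sqrtm_blockMat hn h1 h2 hl,
    inv_blockMat hn h2.isUnit fun k => (Real.sqrt_pos.mpr (hl k)).ne']
  rfl

theorem blockMat_mulVec (M : Matrix (Fin K) (Fin K) ℝ) (d : Fin K → ℝ) (z : Idx n → ℝ)
    (x : Idx n) : (blockMat n M d *ᵥ z) x =
      (clusterMat n *ᵥ (M *ᵥ Y0 n z)) x + d x.1 * (withinProj n *ᵥ z) x := by
  rw [blockMat, add_mulVec, Pi.add_apply, ← mulVec_mulVec, ← mulVec_mulVec, ← mulVec_mulVec,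
    mulVec_diagonal, Y0_eq]

end Canonical

/-! ### The score -/

section Score

variable {K : ℕ} {n : Fin K → ℕ}

theorem eventually_stdU_corrOfA (hn : ∀ k, 2 ≤ n k) {A : Matrix (Fin K) (Fin K) ℝ}
    (hA : (corrOfA n A).PosDef) (z : Idx n → ℝ) :
    ∀ᶠ a in nhds (vec A), ∀ x, stdU (corrOfA n (unvec a)) z x =
      (clusterMat n *ᵥ ((sqrtm (unvec a))⁻¹ *ᵥ Y0 n z)) x +
        (√(lam n (unvec a) x.1))⁻¹ * (withinProj n *ᵥ z) x := by
  have h1 := (sqrtm_unvec_regular (posDef_of_posDef_corrOfA hn hA)).1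
  have h2 : ∀ᶠ a in nhds (vec A), ∀ k, 0 < lam n (unvec a) k := by
    rw [Filter.eventually_all]
    intro k
    have hc : Continuous fun a : Fin K × Fin K → ℝ => lam n (unvec a) k := by
      simp only [lam, unvec, of_apply]
      fun_prop
    exact hc.continuousAt.eventually (lt_mem_nhds (lam_pos_of_posDef_corrOfA hn hA k))
  filter_upwards [h1, h2] with a ha1 ha2 x
  rw [stdU, invSqrtm_corrOfA hn ha1.1 ha1.2 ha2, blockMat_mulVec]

theorem differentiableAt_logLikVecA (hn : ∀ k, 2 ≤ n k) {ν : Idx n → ℝ} (hν : ∀ x, 2 < ν x)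
    {A : Matrix (Fin K) (Fin K) ℝ} (hA : (corrOfA n A).PosDef) (z : Idx n → ℝ) :
    (∀ x, DifferentiableAt ℝ (fun a => stdU (corrOfA n (unvec a)) z x) (vec A)) ∧
    DifferentiableAt ℝ (fun a => (corrOfA n (unvec a)).det) (vec A) ∧
    DifferentiableAt ℝ (logLikVecA n ν z) (vec A) := by
  have hU : ∀ x, DifferentiableAt ℝ (fun a => stdU (corrOfA n (unvec a)) z x) (vec A) := by
    intro x
    have hR := (sqrtm_unvec_regular (posDef_of_posDef_corrOfA hn hA)).2.2
    have hl : DifferentiableAt ℝ (fun a : Fin K × Fin K → ℝ => lam n (unvec a) x.1) (vec A) := by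
      simp only [lam, unvec, of_apply]
      fun_prop
    have hlp : 0 < lam n (unvec (vec A)) x.1 := lam_pos_of_posDef_corrOfA hn hA x.1
    refine DifferentiableAt.congr_of_eventuallyEq (f := fun a =>
      (clusterMat n *ᵥ ((sqrtm (unvec a))⁻¹ *ᵥ Y0 n z)) x +
        (√(lam n (unvec a) x.1))⁻¹ * (withinProj n *ᵥ z) x) ?_
      ((eventually_stdU_corrOfA hn hA z).mono fun a ha => ha x)
    refine DifferentiableAt.add ?_ ?_
    · simp only [mulVec, dotProduct]
      refine DifferentiableAt.fun_sum fun k _ => DifferentiableAt.const_mul ?_ _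
      exact DifferentiableAt.fun_sum fun l _ => (hR k l).mul_const _
    · exact ((hl.sqrt hlp.ne').fun_inv (Real.sqrt_pos.mpr hlp).ne').mul_const _
  have hd : DifferentiableAt ℝ (fun a => (corrOfA n (unvec a)).det) (vec A) := by
    refine differentiableAt_det fun x y => ?_
    simp only [corrOfA, blockCorr, rhoOfA, unvec, of_apply]
    split_ifs <;> fun_prop
  refine ⟨hU, hd, ?_⟩
  have hd0 : (corrOfA n (unvec (vec A))).det ≠ 0 := hA.det_pos.ne'
  refine DifferentiableAt.add ((hd.log hd0).const_mul _) ?_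
  refine DifferentiableAt.fun_sum fun x _ => ?_
  exact (hasDerivAt_log_tStdPDF (hν x) _).differentiableAt.comp (vec A) (hU x)

theorem trace_inv_mul_of_sq {ι : Type*} [Fintype ι] [DecidableEq ι] {R D : Matrix ι ι ℝ}
    (hR : IsUnit R) :
    ((R * R)⁻¹ * (R * D + D * R)).trace = 2 * (R⁻¹ * D).trace := by
  have hd := (isUnit_iff_isUnit_det _).mp hR
  rw [Matrix.mul_inv_rev, Matrix.mul_add, trace_add, two_mul]
  congr 1
  · rw [Matrix.mul_assoc, ← Matrix.mul_assoc R⁻¹ R, nonsing_inv_mul _ hd, Matrix.one_mul]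
  · rw [← Matrix.mul_assoc, trace_mul_comm, ← Matrix.mul_assoc, ← Matrix.mul_assoc,
      mul_nonsing_inv _ hd, Matrix.one_mul]

/-- The directional derivative of the log-likelihood, in terms of the derivative `D` of the
square root of `A`. -/
theorem exists_fderiv_logLikVecA (hn : ∀ k, 2 ≤ n k) {ν : Idx n → ℝ} (hν : ∀ x, 2 < ν x)
    {A : Matrix (Fin K) (Fin K) ℝ} (hA : (corrOfA n A).PosDef) (z : Idx n → ℝ)
    (H : Matrix (Fin K) (Fin K) ℝ) :
    ∃ D : Matrix (Fin K) (Fin K) ℝ, sqrtm A * D + D * sqrtm A = H ∧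
      fderiv ℝ (logLikVecA n ν z) (vec A) (vec H) =
        ((clusterMat n)ᵀ *ᵥ fun x => weight ν (stdU (corrOfA n A) z) x * stdU (corrOfA n A) z x) ⬝ᵥ
          (invSqrtm A * D) *ᵥ X0 n A z - (invSqrtm A * D).trace +
        1 / 2 * ∑ k, H k k * Svec n ν A (stdU (corrOfA n A) z) k := by
  have hAp := posDef_of_posDef_corrOfA hn hA
  have hl := lam_pos_of_posDef_corrOfA hn hA
  have hRp := posDef_sqrtm hAp
  have hRdet := (isUnit_iff_isUnit_det _).mp hRp.isUnit
  obtain ⟨hev, hRd, hQd⟩ := sqrtm_unvec_regular hAp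
  obtain ⟨hUd, hdetd, hLd⟩ := differentiableAt_logLikVecA hn hν hA z
  set u := stdU (corrOfA n A) z with hu
  let γ : ℝ → (Fin K × Fin K → ℝ) := fun t => vec A + t • vec H
  have hγ0 : γ 0 = vec A := by simp [γ]
  have hγu : ∀ t, unvec (γ t) = A + t • H := fun t => rfl
  have hγ : HasDerivAt γ (vec H) 0 := by
    simpa [γ] using ((hasDerivAt_id (0 : ℝ)).smul_const (vec H)).const_add (vec A)
  have hcomp : ∀ f : (Fin K × Fin K → ℝ) → ℝ, DifferentiableAt ℝ f (vec A) →
      HasDerivAt (fun t => f (γ t)) (fderiv ℝ f (vec A) (vec H)) 0 := by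
    intro f hf
    have h := hf.hasFDerivAt
    rw [← hγ0] at h
    have h2 := h.comp_hasDerivAt (0 : ℝ) hγ
    rwa [hγ0] at h2
  have hγt : Filter.Tendsto γ (nhds 0) (nhds (vec A)) := by
    have := hγ.continuousAt.tendsto
    rwa [hγ0] at this
  have hγ0' : unvec (γ 0) = A := by rw [hγ0]; rfl
  set D : Matrix (Fin K) (Fin K) ℝ :=
    Matrix.of fun i j => fderiv ℝ (fun a => sqrtm (unvec a) i j) (vec A) (vec H)
  set Q : Matrix (Fin K) (Fin K) ℝ :=
    Matrix.of fun i j => fderiv ℝ (fun a => (sqrtm (unvec a))⁻¹ i j) (vec A) (vec H)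
  have hR' : ∀ i j, HasDerivAt (fun t => sqrtm (unvec (γ t)) i j) (D i j) 0 :=
    fun i j => hcomp _ (hRd i j)
  have hQ' : ∀ i j, HasDerivAt (fun t => (sqrtm (unvec (γ t)))⁻¹ i j) (Q i j) 0 :=
    fun i j => hcomp _ (hQd i j)
  -- Differentiate `R(t)² = A + tH` at `0`.
  have hD : sqrtm A * D + D * sqrtm A = H := by
    ext i j
    have h1 := hasDerivAt_mul_apply hR' hR' i j
    have h2 : HasDerivAt (fun t : ℝ => (A + t • H) i j) (H i j) 0 := by
      simpa using ((hasDerivAt_id (0 : ℝ)).mul_const (H i j)).const_add (A i j)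
    have h3 : (fun t => (sqrtm (unvec (γ t)) * sqrtm (unvec (γ t))) i j) =ᶠ[nhds 0]
        fun t : ℝ => (A + t • H) i j := by
      filter_upwards [hγt.eventually hev] with t ht
      rw [ht.1, hγu]
    have := h1.unique (h2.congr_of_eventuallyEq h3)
    rw [hγ0', add_comm] at this
    exact this
  -- Differentiate `R(t)⁻¹ R(t) = 1` at `0`.
  have hQ : Q = -((sqrtm A)⁻¹ * D * (sqrtm A)⁻¹) := by
    have h0 : Q * sqrtm A + (sqrtm A)⁻¹ * D = 0 := by
      ext i j
      have h1 := hasDerivAt_mul_apply hQ' hR' i j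
      have h3 : (fun t => ((sqrtm (unvec (γ t)))⁻¹ * sqrtm (unvec (γ t))) i j) =ᶠ[nhds 0]
          fun _ : ℝ => (1 : Matrix (Fin K) (Fin K) ℝ) i j := by
        filter_upwards [hγt.eventually hev] with t ht
        rw [nonsing_inv_mul _ ((isUnit_iff_isUnit_det _).mp ht.2.isUnit)]
      have := h1.unique ((hasDerivAt_const (0 : ℝ) _).congr_of_eventuallyEq h3)
      rwa [hγ0'] at this
    have h1 := congrArg (fun M => M * (sqrtm A)⁻¹) h0
    simp only [Matrix.add_mul, Matrix.mul_assoc, mul_nonsing_inv _ hRdet, Matrix.mul_one,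
      Matrix.zero_mul] at h1
    rw [Matrix.mul_assoc]
    exact eq_neg_of_add_eq_zero_left h1
  refine ⟨D, hD, ?_⟩
  -- `λ_k` is affine in `A_{kk}` with slope `-1/(n_k - 1)`, which gives `λ_k^{-1/2}` a positive
  -- coefficient.
  have hlam : ∀ k, HasDerivAt (fun t => (√(lam n (unvec (γ t)) k))⁻¹)
      (1 / 2 * (H k k / (((n k : ℝ) - 1) * lam n A k)) * (√(lam n A k))⁻¹) 0 := by
    intro k
    have h1 : HasDerivAt (fun t => lam n (unvec (γ t)) k) (-(H k k) / ((n k : ℝ) - 1)) 0 := by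
      simp_rw [hγu, lam_add_smul]
      simpa using ((hasDerivAt_id (0 : ℝ)).mul_const (-(H k k) / ((n k : ℝ) - 1))).const_add
        (lam n A k)
    have hp : 0 < lam n (unvec (γ 0)) k := by rw [hγ0']; exact hl k
    have h2 := (h1.sqrt hp.ne').fun_inv (Real.sqrt_pos.mpr hp).ne'
    rw [hγ0'] at h2
    refine h2.congr_deriv ?_
    have h3 := Real.sq_sqrt (hl k).le
    have h4 := (Real.sqrt_pos.mpr (hl k)).ne'
    have h5 := (natCast_sub_one_pos hn k).ne'
    have h6 := (hl k).ne'
    rw [h3]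
    field_simp
  have hwu : ∀ x : Idx n, (withinProj n *ᵥ u) x =
      (√(lam n A x.1))⁻¹ * (withinProj n *ᵥ z) x := by
    intro x
    rw [hu, stdU, invSqrtm_corrOfA hn (sqrtm_mul_sqrtm hAp) hRp.accretive hl, mulVec_mulVec,
      withinProj_mul_blockMat hn, ← mulVec_mulVec, mulVec_diagonal]
  have hU' : ∀ x : Idx n, HasDerivAt (fun t => stdU (corrOfA n (unvec (γ t))) z x)
      ((clusterMat n *ᵥ (Q *ᵥ Y0 n z)) x +
        1 / 2 * (H x.1 x.1 / (((n x.1 : ℝ) - 1) * lam n A x.1)) * (withinProj n *ᵥ u) x) 0 := by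
    intro x
    have h1 : HasDerivAt (fun t => (clusterMat n *ᵥ ((sqrtm (unvec (γ t)))⁻¹ *ᵥ Y0 n z)) x +
        (√(lam n (unvec (γ t)) x.1))⁻¹ * (withinProj n *ᵥ z) x)
        ((clusterMat n *ᵥ (Q *ᵥ Y0 n z)) x +
        1 / 2 * (H x.1 x.1 / (((n x.1 : ℝ) - 1) * lam n A x.1)) * (√(lam n A x.1))⁻¹ *
          (withinProj n *ᵥ z) x) 0 := by
      refine HasDerivAt.add ?_ ((hlam x.1).mul_const _)
      simp only [mulVec, dotProduct]
      refine HasDerivAt.fun_sum fun k _ => HasDerivAt.const_mul _ ?_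
      exact HasDerivAt.fun_sum fun l _ => (hQ' k l).mul_const _
    have h2 := h1.congr_of_eventuallyEq
      ((hγt.eventually (eventually_stdU_corrOfA hn hA z)).mono fun t ht => ht x)
    rw [hwu, ← mul_assoc]
    exact h2
  -- In the trace of `C⁻¹ dC` the multiplicity `n_k - 1` of `λ_k` cancels the denominator of its
  -- slope.
  have hdet : HasDerivAt (fun t => (corrOfA n (unvec (γ t))).det)
      ((corrOfA n A).det * ((A⁻¹ * H).trace - ∑ k, H k k / lam n A k)) 0 := by
    simp_rw [hγu, corrOfA_add_smul hn]
    refine (hasDerivAt_det_add_smul hA.isUnit _).congr_deriv ?_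
    rw [corrOfA_eq_blockMat hn, inv_blockMat hn hAp.isUnit (fun k => (hl k).ne'),
      blockMat_mul_blockMat hn, trace_blockMat hn, sub_eq_add_neg, ← Finset.sum_neg_distrib]
    congr 3
    ext k
    have h5 := (natCast_sub_one_pos hn k).ne'
    have h6 := (hl k).ne'
    simp only [Pi.mul_apply, Pi.inv_apply]
    field_simp
  have hL : HasDerivAt (fun t => logLikVecA n ν z (γ t))
      (-(1 / 2) * ((A⁻¹ * H).trace - ∑ k, H k k / lam n A k) +
        ∑ x : Idx n, -(weight ν u x * u x) * ((clusterMat n *ᵥ (Q *ᵥ Y0 n z)) x +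
        1 / 2 * (H x.1 x.1 / (((n x.1 : ℝ) - 1) * lam n A x.1)) * (withinProj n *ᵥ u) x)) 0 := by
    have hdp : 0 < (corrOfA n (unvec (γ 0))).det := by rw [hγ0']; exact hA.det_pos
    refine HasDerivAt.add (HasDerivAt.const_mul _ ?_) (HasDerivAt.fun_sum fun x _ => ?_)
    · refine (hdet.log hdp.ne').congr_deriv ?_
      rw [hγ0', mul_div_cancel_left₀ _ hA.det_pos.ne']
    · have h1 := hasDerivAt_log_tStdPDF (hν x) (stdU (corrOfA n (unvec (γ 0))) z x)
      have h2 := h1.comp 0 (hU' x)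
      rw [hγ0'] at h2
      exact h2
  rw [(hcomp _ hLd).unique hL]
  have e1 : (A⁻¹ * H).trace = 2 * (invSqrtm A * D).trace := by
    rw [invSqrtm, ← trace_inv_mul_of_sq hRp.isUnit, hD, sqrtm_mul_sqrtm hAp]
  have e2 : ∑ x : Idx n, (weight ν u x * u x) * (clusterMat n *ᵥ (Q *ᵥ Y0 n z)) x =
      -(((clusterMat n)ᵀ *ᵥ fun x => weight ν u x * u x) ⬝ᵥ (invSqrtm A * D) *ᵥ X0 n A z) := by
    change (fun x => weight ν u x * u x) ⬝ᵥ (clusterMat n *ᵥ (Q *ᵥ Y0 n z)) = _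
    rw [dotProduct_mulVec, ← mulVec_transpose, hQ, neg_mulVec, dotProduct_neg, X0, mulVec_mulVec]
    rfl
  have e3 : ∑ k, H k k * Svec n ν A u k = ∑ k, H k k / lam n A k -
      ∑ x : Idx n, weight ν u x * u x *
        (H x.1 x.1 / (((n x.1 : ℝ) - 1) * lam n A x.1) * (withinProj n *ᵥ u) x) := by
    simp_rw [Svec_eq, sum_idx_ite, mul_sub, Finset.sum_sub_distrib, Fintype.sum_sigma]
    congr 1
    · exact Finset.sum_congr rfl fun k _ => by ring
    · refine Finset.sum_congr rfl fun k _ => ?_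
      rw [Finset.sum_div, Finset.mul_sum]
      exact Finset.sum_congr rfl fun i _ => by ring
  have e4 : ∑ x : Idx n, -(weight ν u x * u x) * ((clusterMat n *ᵥ (Q *ᵥ Y0 n z)) x +
        1 / 2 * (H x.1 x.1 / (((n x.1 : ℝ) - 1) * lam n A x.1)) * (withinProj n *ᵥ u) x) =
      -∑ x : Idx n, (weight ν u x * u x) * (clusterMat n *ᵥ (Q *ᵥ Y0 n z)) x -
      1 / 2 * ∑ x : Idx n, weight ν u x * u x *
        (H x.1 x.1 / (((n x.1 : ℝ) - 1) * lam n A x.1) * (withinProj n *ᵥ u) x) := by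
    rw [Finset.mul_sum, ← Finset.sum_neg_distrib, ← Finset.sum_sub_distrib]
    exact Finset.sum_congr rfl fun x _ => by ring
  rw [e4, e3, e2, e1]
  ring

/-- The score in closed form. -/
theorem scoreA_eq (hn : ∀ k, 2 ≤ n k) {ν : Idx n → ℝ} (hν : ∀ x, 2 < ν x)
    {A : Matrix (Fin K) (Fin K) ℝ} (hA : (corrOfA n A).PosDef) (z : Idx n → ℝ) :
    scoreA n ν A z = OmegaA A *ᵥ (vec (vecMulVec ((clusterMat n)ᵀ *ᵥ fun x =>
        weight ν (stdU (corrOfA n A) z) x * stdU (corrOfA n A) z x) (X0 n A z)) -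
          vec (1 : Matrix (Fin K) (Fin K) ℝ)) +
      (1 / 2 : ℝ) • ((elimDiag (Fin K))ᵀ *ᵥ Svec n ν A (stdU (corrOfA n A) z)) := by
  have hAp := posDef_of_posDef_corrOfA hn hA
  set u := stdU (corrOfA n A) z
  set g := (clusterMat n)ᵀ *ᵥ fun x => weight ν u x * u x
  ext p
  -- `vec` stacks columns, so an index `p` is a pair (column, row).
  have hs : Pi.single p (1 : ℝ) = vec (Matrix.single p.2 p.1 (1 : ℝ)) := by
    rw [vec_single]
  obtain ⟨D, hD, hf⟩ := exists_fderiv_logLikVecA hn hν hA z (Matrix.single p.2 p.1 (1 : ℝ))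
  rw [scoreA, hs, hf]
  set H := Matrix.single p.2 p.1 (1 : ℝ)
  have h1 : ∀ b : Fin K × Fin K → ℝ, b p = vec H ⬝ᵥ b := by
    intro b
    rw [← hs]
    simp
  -- Symmetry moves `Ω_A` onto `vec H`, where it acts through the Sylvester equation; pairings of
  -- `vec`s then become traces.
  rw [h1 (_ + _), dotProduct_add, dotProduct_mulVec (vec H) (OmegaA A), ← mulVec_transpose (OmegaA A),
    OmegaA_transpose hAp, ← hD, OmegaA_mulVec_vec hAp, ← vec_sub, vec_dotProduct_vec, Matrix.mul_sub, Matrix.mul_one,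
    trace_sub, trace_transpose, hD, dotProduct_smul, dotProduct_mulVec (vec H),
    vecMul_transpose,
    elimDiag_mulVec_vec, mul_vecMulVec, trace_vecMulVec]
  congr 2
  rw [mulVec_transpose (invSqrtm A * D), ← dotProduct_mulVec]

end Score

/-! ### One-dimensional moments of the `t`-distribution -/

section TMoments

/-- Write the power as a Gamma integral in `t` and exchange the integrals: the Gaussian integral in
`y` contributes `t^{-1/2}`, leaving `Γ(s - 1/2)`. Working with `∫⁻` yields integrability as well. -/
theorem lintegral_one_add_sq_div_rpow {c s : ℝ} (hc : 0 < c) (hs : 1 / 2 < s) :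
    ∫⁻ y : ℝ, ENNReal.ofReal ((1 + y ^ 2 / c) ^ (-s)) =
      ENNReal.ofReal (√(Real.pi * c) * Real.Gamma (s - 1 / 2) / Real.Gamma s) := by
  have hs0 : 0 < s := by linarith
  have hG : 0 < Real.Gamma s := Real.Gamma_pos_of_pos hs0
  have hpi := Real.pi_pos
  have hb : ∀ y : ℝ, 0 < 1 + y ^ 2 / c := fun y => by positivity
  have h1 : ∀ y : ℝ, ENNReal.ofReal ((1 + y ^ 2 / c) ^ (-s)) = ENNReal.ofReal (Real.Gamma s)⁻¹ *
      ∫⁻ t in Set.Ioi (0 : ℝ), ENNReal.ofReal (t ^ (s - 1) * Real.exp (-((1 + y ^ 2 / c) * t))) := by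
    intro y
    have hi := Real.integral_rpow_mul_exp_neg_mul_Ioi hs0 (hb y)
    have hint : IntegrableOn (fun t : ℝ => t ^ (s - 1) * Real.exp (-((1 + y ^ 2 / c) * t)))
        (Set.Ioi 0) := by
      refine not_imp_comm.1 integral_undef ?_
      rw [hi]
      have := hb y
      positivity
    rw [← ofReal_integral_eq_lintegral_ofReal hint, hi, ← ENNReal.ofReal_mul (by positivity)]
    · congr 1
      rw [one_div, Real.inv_rpow (hb y).le, ← Real.rpow_neg (hb y).le]
      field_simp
    · filter_upwards [ae_restrict_mem measurableSet_Ioi] with t ht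
      have ht : 0 < t := ht
      simp only [Pi.zero_apply]
      positivity
  have h2 : ∀ t : ℝ, t ∈ Set.Ioi (0 : ℝ) →
      ∫⁻ y : ℝ, ENNReal.ofReal (t ^ (s - 1) * Real.exp (-((1 + y ^ 2 / c) * t))) =
        ENNReal.ofReal (√(Real.pi * c) * (Real.exp (-t) * t ^ (s - 1 / 2 - 1))) := by
    intro t ht
    have ht : 0 < t := ht
    have he : ∀ y : ℝ, t ^ (s - 1) * Real.exp (-((1 + y ^ 2 / c) * t)) =
        t ^ (s - 1) * Real.exp (-t) * Real.exp (-(t / c) * y ^ 2) := by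
      intro y
      rw [mul_assoc, ← Real.exp_add]
      congr 2
      field_simp
      ring
    simp_rw [he]
    rw [← ofReal_integral_eq_lintegral_ofReal
      ((integrable_exp_neg_mul_sq (by positivity)).const_mul _)
      (Filter.Eventually.of_forall fun y => by simp only [Pi.zero_apply]; positivity),
      integral_const_mul, integral_gaussian]
    congr 1
    have e1 : Real.pi / (t / c) = Real.pi * c * t⁻¹ := by field_simp
    rw [e1, Real.sqrt_mul (by positivity), Real.sqrt_inv, Real.sqrt_eq_rpow t,
      ← Real.rpow_neg ht.le, show s - 1 / 2 - 1 = (s - 1) + (-(1 / 2)) by ring,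
      Real.rpow_add ht]
    ring
  simp_rw [h1]
  rw [lintegral_const_mul' _ _ ENNReal.ofReal_ne_top, lintegral_lintegral_swap,
    setLIntegral_congr_fun measurableSet_Ioi h2, ← ofReal_integral_eq_lintegral_ofReal,
    integral_const_mul, ← Real.Gamma_eq_integral (by linarith), ← ENNReal.ofReal_mul (by positivity)]
  · congr 1
    field_simp
  · exact (Real.GammaIntegral_convergent (by linarith)).const_mul _
  · filter_upwards [ae_restrict_mem measurableSet_Ioi] with t ht
    have ht : 0 < t := ht
    simp only [Pi.zero_apply]
    positivity
  · refine Measurable.aemeasurable ?_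
    simp only [Function.uncurry_def]
    fun_prop

theorem continuous_tBase {c : ℝ} (hc : 0 < c) (s : ℝ) :
    Continuous fun y : ℝ => (1 + y ^ 2 / c) ^ s := by
  refine Continuous.rpow_const (by fun_prop) fun y => Or.inl ?_
  positivity

theorem integrable_one_add_sq_div_rpow {c s : ℝ} (hc : 0 < c) (hs : 1 / 2 < s) :
    Integrable fun y : ℝ => (1 + y ^ 2 / c) ^ (-s) := by
  rw [← lintegral_ofReal_ne_top_iff_integrable (continuous_tBase hc _).aestronglyMeasurable
    (Filter.Eventually.of_forall fun y => by simp only [Pi.zero_apply]; positivity),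
    lintegral_one_add_sq_div_rpow hc hs]
  exact ENNReal.ofReal_ne_top

theorem integral_one_add_sq_div_rpow {c s : ℝ} (hc : 0 < c) (hs : 1 / 2 < s) :
    ∫ y : ℝ, (1 + y ^ 2 / c) ^ (-s) =
      √(Real.pi * c) * Real.Gamma (s - 1 / 2) / Real.Gamma s := by
  have h1 := Real.Gamma_pos_of_pos (show 0 < s by linarith)
  have h2 := Real.Gamma_pos_of_pos (show 0 < s - 1 / 2 by linarith)
  rw [integral_eq_lintegral_of_nonneg_ae
    (Filter.Eventually.of_forall fun y => by simp only [Pi.zero_apply]; positivity)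
    (continuous_tBase hc _).aestronglyMeasurable, lintegral_one_add_sq_div_rpow hc hs,
    ENNReal.toReal_ofReal (by positivity)]

variable {ν : ℝ}

theorem continuous_tStdPDF (hν : 2 < ν) : Continuous (tStdPDF ν) :=
  continuous_const.mul (continuous_tBase (by linarith) _)

theorem integral_tStd (hν : 2 < ν) (f : ℝ → ℝ) :
    ∫ y, f y ∂(tStd ν) = ∫ y, tStdPDF ν y * f y := by
  rw [tStd, integral_withDensity_eq_integral_toReal_smul
    (continuous_tStdPDF hν).measurable.ennreal_ofReal
    (Filter.Eventually.of_forall fun _ => ENNReal.ofReal_lt_top)]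
  simp_rw [ENNReal.toReal_ofReal (tStdPDF_pos hν _).le, smul_eq_mul]

theorem integrable_tStd_iff (hν : 2 < ν) {f : ℝ → ℝ} :
    Integrable f (tStd ν) ↔ Integrable fun y => tStdPDF ν y * f y := by
  rw [tStd, integrable_withDensity_iff (continuous_tStdPDF hν).measurable.ennreal_ofReal
    (Filter.Eventually.of_forall fun _ => ENNReal.ofReal_lt_top)]
  simp_rw [ENNReal.toReal_ofReal (tStdPDF_pos hν _).le, mul_comm]

/-- A power of `1 + y²/(ν - 2)` only shifts the exponent of the density, so its expectation is a
quotient of Gamma values. -/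
theorem tStdPDF_mul_rpow (hν : 2 < ν) (j y : ℝ) :
    tStdPDF ν y * (1 + y ^ 2 / (ν - 2)) ^ j =
      Real.Gamma ((ν + 1) / 2) / Real.Gamma (ν / 2) * ((ν - 2) * Real.pi) ^ (-(1 / 2) : ℝ) *
        (1 + y ^ 2 / (ν - 2)) ^ (-((ν + 1) / 2 - j)) := by
  have h : 0 < ν - 2 := by linarith
  have hb : 0 < 1 + y ^ 2 / (ν - 2) := by positivity
  rw [tStdPDF, mul_assoc, ← Real.rpow_add hb]
  congr 2
  ring

theorem integrable_tStd_rpow (hν : 2 < ν) {j : ℝ} (hj : j < ν / 2) :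
    Integrable (fun y => (1 + y ^ 2 / (ν - 2)) ^ j) (tStd ν) := by
  rw [integrable_tStd_iff hν]
  simp_rw [tStdPDF_mul_rpow hν]
  exact (integrable_one_add_sq_div_rpow (by linarith) (by linarith)).const_mul _

theorem integral_tStd_rpow (hν : 2 < ν) {j : ℝ} (hj : j < ν / 2) :
    ∫ y, (1 + y ^ 2 / (ν - 2)) ^ j ∂(tStd ν) =
      Real.Gamma ((ν + 1) / 2) / Real.Gamma (ν / 2) *
        (Real.Gamma (ν / 2 - j) / Real.Gamma ((ν + 1) / 2 - j)) := by
  have h : 0 < ν - 2 := by linarith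
  have hpi := Real.pi_pos
  rw [integral_tStd hν]
  simp_rw [tStdPDF_mul_rpow hν]
  rw [integral_const_mul, integral_one_add_sq_div_rpow (by linarith) (by linarith),
    Real.rpow_neg (by positivity), ← Real.sqrt_eq_rpow, mul_comm Real.pi,
    show (ν + 1) / 2 - j - 1 / 2 = ν / 2 - j by ring]
  have : √((ν - 2) * Real.pi) ≠ 0 := by positivity
  field_simp

theorem integral_tStd_rpow_zero (hν : 2 < ν) :
    ∫ y, (1 + y ^ 2 / (ν - 2)) ^ (0 : ℝ) ∂(tStd ν) = 1 := by
  have h1 := Real.Gamma_pos_of_pos (show 0 < (ν + 1) / 2 by linarith)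
  have h2 := Real.Gamma_pos_of_pos (show 0 < ν / 2 by linarith)
  rw [integral_tStd_rpow hν (by linarith), sub_zero, sub_zero]
  field_simp

theorem integral_tStd_rpow_one (hν : 2 < ν) :
    ∫ y, (1 + y ^ 2 / (ν - 2)) ^ (1 : ℝ) ∂(tStd ν) = (ν - 1) / (ν - 2) := by
  have h1 := Real.Gamma_pos_of_pos (show 0 < (ν + 1) / 2 - 1 by linarith)
  have h2 := Real.Gamma_pos_of_pos (show 0 < ν / 2 - 1 by linarith)
  have e1 := Real.Gamma_add_one (show (ν + 1) / 2 - 1 ≠ 0 by linarith)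
  have e2 := Real.Gamma_add_one (show ν / 2 - 1 ≠ 0 by linarith)
  rw [sub_add_cancel] at e1 e2
  have h3 : ν - 2 ≠ 0 := by linarith
  have h4 : ν / 2 - 1 ≠ 0 := by linarith
  rw [integral_tStd_rpow hν (by linarith), e1, e2]
  generalize Real.Gamma ((ν + 1) / 2 - 1) = g₁ at h1
  generalize Real.Gamma (ν / 2 - 1) = g₂ at h2
  field_simp
  ring

theorem integral_tStd_rpow_neg_one (hν : 2 < ν) :
    ∫ y, (1 + y ^ 2 / (ν - 2)) ^ (-1 : ℝ) ∂(tStd ν) = ν / (ν + 1) := by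
  have h1 := Real.Gamma_pos_of_pos (show 0 < (ν + 1) / 2 by linarith)
  have h2 := Real.Gamma_pos_of_pos (show 0 < ν / 2 by linarith)
  have h3 : ν + 1 ≠ 0 := by linarith
  rw [integral_tStd_rpow hν (by linarith), sub_neg_eq_add, sub_neg_eq_add,
    Real.Gamma_add_one (show (ν + 1) / 2 ≠ 0 by linarith),
    Real.Gamma_add_one (show ν / 2 ≠ 0 by linarith)]
  field_simp

theorem integral_tStd_rpow_neg_two (hν : 2 < ν) :
    ∫ y, (1 + y ^ 2 / (ν - 2)) ^ (-2 : ℝ) ∂(tStd ν) =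
      ν * (ν + 2) / ((ν + 1) * (ν + 3)) := by
  have h1 := Real.Gamma_pos_of_pos (show 0 < (ν + 1) / 2 by linarith)
  have h2 := Real.Gamma_pos_of_pos (show 0 < ν / 2 by linarith)
  have h3 : ν + 1 ≠ 0 := by linarith
  have h4 : ν + 3 ≠ 0 := by linarith
  rw [integral_tStd_rpow hν (by linarith), sub_neg_eq_add, sub_neg_eq_add,
    show (ν + 1) / 2 + 2 = (ν + 1) / 2 + 1 + 1 by ring, show ν / 2 + 2 = ν / 2 + 1 + 1 by ring,
    Real.Gamma_add_one (show (ν + 1) / 2 + 1 ≠ 0 by linarith),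
    Real.Gamma_add_one (show ν / 2 + 1 ≠ 0 by linarith),
    Real.Gamma_add_one (show (ν + 1) / 2 ≠ 0 by linarith),
    Real.Gamma_add_one (show ν / 2 ≠ 0 by linarith)]
  field_simp
  ring

theorem isProbabilityMeasure_tStd (hν : 2 < ν) : IsProbabilityMeasure (tStd ν) := by
  have h : 0 < ν - 2 := by linarith
  have h1 := integral_tStd_rpow_zero hν
  have h2 := integrable_tStd_rpow hν (j := 0) (by linarith)
  simp only [Real.rpow_zero] at h1 h2
  have hf : IsFiniteMeasure (tStd ν) := by
    simpa [integrable_const_iff] using h2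
  constructor
  have h3 : (tStd ν).real Set.univ = 1 := by simpa using h1
  rw [measureReal_def] at h3
  rw [← ENNReal.ofReal_toReal (measure_ne_top (tStd ν) Set.univ), h3, ENNReal.ofReal_one]

theorem integral_tStd_odd (hν : 2 < ν) {f : ℝ → ℝ} (hf : ∀ y, f (-y) = -f y) :
    ∫ y, f y ∂(tStd ν) = 0 := by
  rw [integral_tStd hν]
  have h := integral_neg_eq_self (fun y => tStdPDF ν y * f y) volume
  have he : ∀ y, tStdPDF ν (-y) * f (-y) = -(tStdPDF ν y * f y) := by
    intro y
    rw [hf, tStdPDF, tStdPDF, neg_sq]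
    ring
  simp_rw [he, integral_neg] at h
  linarith

/-- Minus the derivative of the logarithm of the density. -/
noncomputable def tScore (ν y : ℝ) : ℝ := (ν + 1) / (ν - 2 + y ^ 2) * y

theorem tScore_neg (ν y : ℝ) : tScore ν (-y) = -tScore ν y := by
  simp [tScore]

theorem continuous_tScore (hν : 2 < ν) : Continuous (tScore ν) := by
  have h : 0 < ν - 2 := by linarith
  have : ∀ y : ℝ, ν - 2 + y ^ 2 ≠ 0 := fun y => by positivity
  unfold tScore
  fun_prop (disch := exact this _)

/-- This and the next three identities write the integrands as combinations of `b^j`, with `b = 1 +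
y²/(ν - 2)` and `j` in `{1, 0, -1, -2}`. Finiteness at `j = 1` is exactly `ν > 2`. -/
theorem sq_eq_rpow (hν : 2 < ν) (y : ℝ) :
    y ^ 2 = (ν - 2) * (1 + y ^ 2 / (ν - 2)) ^ (1 : ℝ) - (ν - 2) := by
  have h : 0 < ν - 2 := by linarith
  rw [Real.rpow_one]
  field_simp
  ring

theorem tScore_mul_eq_rpow (hν : 2 < ν) (y : ℝ) :
    tScore ν y * y = (ν + 1) - (ν + 1) * (1 + y ^ 2 / (ν - 2)) ^ (-1 : ℝ) := by
  have h : 0 < ν - 2 := by linarith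
  have h1 : ν - 2 + y ^ 2 ≠ 0 := by positivity
  have h7 : 1 + y ^ 2 / (ν - 2) = (ν - 2 + y ^ 2) / (ν - 2) := by field_simp
  rw [Real.rpow_neg_one, tScore, h7]
  field_simp
  ring

theorem tScore_sq_eq_rpow (hν : 2 < ν) (y : ℝ) :
    tScore ν y ^ 2 = (ν + 1) ^ 2 / (ν - 2) * (1 + y ^ 2 / (ν - 2)) ^ (-1 : ℝ) -
      (ν + 1) ^ 2 / (ν - 2) * (1 + y ^ 2 / (ν - 2)) ^ (-2 : ℝ) := by
  have h : 0 < ν - 2 := by linarith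
  have h1 : ν - 2 + y ^ 2 ≠ 0 := by positivity
  have h7 : 1 + y ^ 2 / (ν - 2) = (ν - 2 + y ^ 2) / (ν - 2) := by field_simp
  rw [show (-2 : ℝ) = ((-2 : ℤ) : ℝ) by norm_num, Real.rpow_intCast, Real.rpow_neg_one, tScore, h7,
    _root_.zpow_neg, zpow_ofNat]
  field_simp
  ring

theorem tScore_sq_mul_sq_eq_rpow (hν : 2 < ν) (y : ℝ) :
    tScore ν y ^ 2 * y ^ 2 = (ν + 1) ^ 2 -
      2 * (ν + 1) ^ 2 * (1 + y ^ 2 / (ν - 2)) ^ (-1 : ℝ) +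
      (ν + 1) ^ 2 * (1 + y ^ 2 / (ν - 2)) ^ (-2 : ℝ) := by
  have h : 0 < ν - 2 := by linarith
  have h1 : ν - 2 + y ^ 2 ≠ 0 := by positivity
  have h7 : 1 + y ^ 2 / (ν - 2) = (ν - 2 + y ^ 2) / (ν - 2) := by field_simp
  rw [show (-2 : ℝ) = ((-2 : ℤ) : ℝ) by norm_num, Real.rpow_intCast, Real.rpow_neg_one, tScore, h7,
    _root_.zpow_neg, zpow_ofNat]
  field_simp
  ring

theorem integral_tStd_sq (hν : 2 < ν) : ∫ y, y ^ 2 ∂(tStd ν) = 1 := by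
  have := isProbabilityMeasure_tStd hν
  have h : ν - 2 ≠ 0 := by linarith
  rw [integral_congr_ae (Filter.Eventually.of_forall (sq_eq_rpow hν)),
    integral_sub ((integrable_tStd_rpow hν (by linarith)).const_mul _) (integrable_const _),
    integral_const_mul, integral_tStd_rpow_one hν]
  simp
  field_simp
  ring

theorem integral_tStd_tScore_mul (hν : 2 < ν) : ∫ y, tScore ν y * y ∂(tStd ν) = 1 := by
  have := isProbabilityMeasure_tStd hν
  have h : ν + 1 ≠ 0 := by linarith
  rw [integral_congr_ae (Filter.Eventually.of_forall (tScore_mul_eq_rpow hν)),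
    integral_sub (integrable_const _) ((integrable_tStd_rpow hν (by linarith)).const_mul _),
    integral_const_mul, integral_tStd_rpow_neg_one hν]
  simp
  field_simp
  ring

theorem integral_tStd_tScore_sq (hν : 2 < ν) : ∫ y, tScore ν y ^ 2 ∂(tStd ν) = psi ν := by
  have := isProbabilityMeasure_tStd hν
  have h : ν + 1 ≠ 0 := by linarith
  have h2 : ν - 2 ≠ 0 := by linarith
  have h3 : ν + 3 ≠ 0 := by linarith
  rw [integral_congr_ae (Filter.Eventually.of_forall (tScore_sq_eq_rpow hν)),
    integral_sub ((integrable_tStd_rpow hν (by linarith)).const_mul _)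
      ((integrable_tStd_rpow hν (by linarith)).const_mul _),
    integral_const_mul, integral_const_mul, integral_tStd_rpow_neg_one hν,
    integral_tStd_rpow_neg_two hν, psi, phi]
  field_simp
  ring

theorem integral_tStd_tScore_sq_mul_sq (hν : 2 < ν) :
    ∫ y, tScore ν y ^ 2 * y ^ 2 ∂(tStd ν) = 3 * phi ν := by
  have := isProbabilityMeasure_tStd hν
  have h : ν + 1 ≠ 0 := by linarith
  have h2 : ν - 2 ≠ 0 := by linarith
  have h3 : ν + 3 ≠ 0 := by linarith
  have i0 := (integrable_const ((ν + 1) ^ 2) (μ := tStd ν))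
  have i1 := (integrable_tStd_rpow hν (j := -1) (by linarith)).const_mul (2 * (ν + 1) ^ 2)
  have i3 : Integrable (fun y => (ν + 1) ^ 2 -
      2 * (ν + 1) ^ 2 * (1 + y ^ 2 / (ν - 2)) ^ (-1 : ℝ)) (tStd ν) := i0.sub i1
  have i2 := (integrable_tStd_rpow hν (j := -2) (by linarith)).const_mul ((ν + 1) ^ 2)
  rw [integral_congr_ae (Filter.Eventually.of_forall (tScore_sq_mul_sq_eq_rpow hν)),
    integral_add i3 i2, integral_sub i0 i1,
    integral_const_mul, integral_const_mul, integral_tStd_rpow_neg_one hν,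
    integral_tStd_rpow_neg_two hν, phi]
  simp
  field_simp
  ring

theorem integrable_tStd_sq (hν : 2 < ν) : Integrable (fun y => y ^ 2) (tStd ν) := by
  -- A non-integrable function would have integral `0`, not `1`.
  refine not_imp_comm.1 integral_undef ?_
  rw [integral_tStd_sq hν]
  exact one_ne_zero

/-- Boundedness of the score makes `h^a U^b` integrable with only second moments of `U`, which is
all that `ν > 2` provides. -/
theorem exists_tScore_bound (hν : 2 < ν) : ∃ c, ∀ y, |tScore ν y| ≤ c := by
  have h : 0 < ν - 2 := by linarith
  -- The factor is chosen so that its product with `ν - 2 + y²` is at least `1 + y²`, hence at least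
  -- `|y|`.
  refine ⟨(ν + 1) * (1 / (ν - 2) + 1), fun y => ?_⟩
  have h1 : 0 < ν - 2 + y ^ 2 := by positivity
  have h4 : |y| ≤ (1 / (ν - 2) + 1) * (ν - 2 + y ^ 2) := by
    have h5 : (1 / (ν - 2) + 1) * (ν - 2 + y ^ 2) = 1 + y ^ 2 + (ν - 2) + y ^ 2 / (ν - 2) := by
      field_simp
      ring
    have h6 : 0 ≤ y ^ 2 / (ν - 2) := by positivity
    have h7 : |y| ^ 2 = y ^ 2 := sq_abs y
    nlinarith [sq_nonneg (|y| - 1)]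
  rw [tScore, abs_mul, abs_div, abs_of_pos (by linarith : 0 < ν + 1), abs_of_pos h1,
    div_mul_eq_mul_div, div_le_iff₀ h1, mul_assoc]
  exact mul_le_mul_of_nonneg_left h4 (by linarith)

theorem integrable_tScore_pow_mul_pow (hν : 2 < ν) (a : ℕ) {b : ℕ} (hb : b ≤ 2) :
    Integrable (fun y => tScore ν y ^ a * y ^ b) (tStd ν) := by
  have := isProbabilityMeasure_tStd hν
  obtain ⟨c, hc⟩ := exists_tScore_bound hν
  have h1 : Integrable (fun y : ℝ => y ^ b) (tStd ν) := by
    refine ((integrable_const (1 : ℝ)).add (integrable_tStd_sq hν)).mono'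
      (by fun_prop) (Filter.Eventually.of_forall fun y => ?_)
    rw [norm_pow, Real.norm_eq_abs, Pi.add_apply, ← sq_abs y]
    interval_cases b
    · simp; positivity
    · nlinarith [sq_nonneg (|y| - 1)]
    · linarith
  refine h1.bdd_mul (c := c ^ a) ((continuous_tScore hν).pow a).aestronglyMeasurable
    (Filter.Eventually.of_forall fun y => ?_)
  rw [norm_pow, Real.norm_eq_abs]
  exact pow_le_pow_left₀ (abs_nonneg _) (hc y) a

end TMoments

/-! ### Covariance of the centred products -/

section PiMoments

/-- The mixed moment of order `(a, b)` of the score and the argument. -/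
noncomputable def tMoment (ν : ℝ) (a b : ℕ) : ℝ := ∫ y, tScore ν y ^ a * y ^ b ∂(tStd ν)

theorem tMoment_of_odd {ν : ℝ} (hν : 2 < ν) {a b : ℕ} (h : Odd (a + b)) : tMoment ν a b = 0 := by
  refine integral_tStd_odd hν fun y => ?_
  rw [tScore_neg, neg_pow, neg_pow y, mul_mul_mul_comm, ← pow_add, h.neg_one_pow]
  ring

theorem tMoment_zero_zero {ν : ℝ} (hν : 2 < ν) : tMoment ν 0 0 = 1 := by
  have := isProbabilityMeasure_tStd hν
  simp [tMoment]

theorem tMoment_zero_two {ν : ℝ} (hν : 2 < ν) : tMoment ν 0 2 = 1 := by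
  simpa [tMoment] using integral_tStd_sq hν

theorem tMoment_one_one {ν : ℝ} (hν : 2 < ν) : tMoment ν 1 1 = 1 := by
  simpa [tMoment] using integral_tStd_tScore_mul hν

theorem tMoment_two_zero {ν : ℝ} (hν : 2 < ν) : tMoment ν 2 0 = psi ν := by
  simpa [tMoment] using integral_tStd_tScore_sq hν

theorem tMoment_two_two {ν : ℝ} (hν : 2 < ν) : tMoment ν 2 2 = 3 * phi ν :=
  integral_tStd_tScore_sq_mul_sq hν

variable {ι : Type*} [Fintype ι] {ν : ι → ℝ}

/-- Independence factorizes mixed moments. Recording exponents as functions on the index set covers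
two-fold and four-fold products through indicator exponents. -/
theorem integral_pi_tScore_pow (hν : ∀ i, 2 < ν i) (a : ι → ℕ) {b : ι → ℕ} (hb : ∀ i, b i ≤ 2) :
    Integrable (fun v : ι → ℝ => (∏ i, tScore (ν i) (v i) ^ a i) * ∏ i, v i ^ b i)
      (Measure.pi fun i => tStd (ν i)) ∧
    ∫ v : ι → ℝ, (∏ i, tScore (ν i) (v i) ^ a i) * ∏ i, v i ^ b i
      ∂(Measure.pi fun i => tStd (ν i)) = ∏ i, tMoment (ν i) (a i) (b i) := by
  have := fun i => isProbabilityMeasure_tStd (hν i)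
  simp_rw [← Finset.prod_mul_distrib]
  exact ⟨Integrable.fintype_prod_dep (f := fun i y => tScore (ν i) y ^ a i * y ^ b i)
      fun i => integrable_tScore_pow_mul_pow (hν i) _ (hb i),
    integral_fintype_prod_eq_prod fun i y => tScore (ν i) y ^ a i * y ^ b i⟩

variable [DecidableEq ι]

theorem integral_pi_tScore_mul (hν : ∀ i, 2 < ν i) (x y : ι) :
    Integrable (fun v : ι → ℝ => tScore (ν x) (v x) * v y) (Measure.pi fun i => tStd (ν i)) ∧
    ∫ v : ι → ℝ, tScore (ν x) (v x) * v y ∂(Measure.pi fun i => tStd (ν i)) =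
      if x = y then 1 else 0 := by
  have h := integral_pi_tScore_pow hν (fun i => if x = i then 1 else 0)
    (b := fun i => if y = i then 1 else 0) (fun i => by split_ifs <;> omega)
  simp only [Finset.prod_pow_boole, Finset.mem_univ, if_true] at h
  refine ⟨h.1, h.2.trans ?_⟩
  by_cases hxy : x = y
  · subst hxy
    rw [if_pos rfl]
    refine Finset.prod_eq_one fun i _ => ?_
    by_cases hi : x = i
    · simp [hi, tMoment_one_one (hν i)]
    · simp [hi, tMoment_zero_zero (hν i)]
  · rw [if_neg hxy]
    refine Finset.prod_eq_zero (Finset.mem_univ x) ?_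
    simp only [if_true, Ne.symm hxy, if_false]
    exact tMoment_of_odd (hν x) (by decide)

/-- The covariance of `h_x U_y` and `h_z U_w`, where `h` is the score of the density and `U` has
independent standardized `t`-distributed coordinates. -/
noncomputable def covEntry (ν : ι → ℝ) (x y z w : ι) : ℝ :=
  (if x = w ∧ y = z then 1 else 0) + (if x = z ∧ y = w then psi (ν x) else 0) +
    if x = y ∧ y = z ∧ z = w then 3 * phi (ν x) - 2 - psi (ν x) else 0

/-- A coordinate of odd total exponent annihilates the product, so only the three pairings of `x, y,
z, w` survive. When all four agree, the pairings would give `1 + 1 + ψ` instead of `3φ`, whence the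
correction `3φ - 2 - ψ`. -/
theorem prod_tMoment (hν : ∀ i, 2 < ν i) (x y z w : ι) :
    ∏ i, tMoment (ν i) ((if x = i then 1 else 0) + if z = i then 1 else 0)
      ((if y = i then 1 else 0) + if w = i then 1 else 0) =
    covEntry ν x y z w + if x = y ∧ z = w then 1 else 0 := by
  have h00 := fun i => tMoment_zero_zero (hν i)
  have h11 := fun i => tMoment_one_one (hν i)
  have h02 := fun i => tMoment_zero_two (hν i)
  have h20 := fun i => tMoment_two_zero (hν i)
  have h22 := fun i => tMoment_two_two (hν i)
  have hz : ∀ i a b, Odd (a + b) → tMoment (ν i) a b = 0 := fun i a b => tMoment_of_odd (hν i)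
  have h10 := fun i => hz i 1 0 (by decide)
  have h01 := fun i => hz i 0 1 (by decide)
  have h12 := fun i => hz i 1 2 (by decide)
  have h21 := fun i => hz i 2 1 (by decide)
  unfold covEntry
  by_cases hxz : x = z
  · subst hxz
    by_cases hyw : y = w
    · subst hyw
      by_cases hxy : x = y
      · subst hxy
        rw [Finset.prod_eq_single x]
        · simp [h22]
          ring
        · intro i _ hi
          simp [Ne.symm hi, h00]
        · simp
      · rw [Finset.prod_eq_mul x y hxy]
        · simp [hxy, Ne.symm hxy, h20, h02]
        · intro i _ hi
          simp [Ne.symm hi.1, Ne.symm hi.2, h00]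
        · simp
        · simp
    · by_cases hxy : x = y
      · subst hxy
        rw [Finset.prod_eq_zero (Finset.mem_univ w)]
        · simp [hyw]
        · simp [hyw, h01]
      · rw [Finset.prod_eq_zero (Finset.mem_univ y)]
        · simp [hyw, hxy, Ne.symm hxy]
        · simp [hxy, Ne.symm hyw, h01]
  · by_cases hxy : x = y
    · subst hxy
      by_cases hzw : z = w
      · subst hzw
        rw [Finset.prod_eq_one]
        · simp [hxz]
        · intro i _
          by_cases h1 : x = i
          · subst h1; simp [Ne.symm hxz, h11]
          · by_cases h2 : z = i
            · subst h2; simp [h1, h11]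
            · simp [h1, h2, h00]
      · rw [Finset.prod_eq_zero (Finset.mem_univ z)]
        · simp [hxz, hzw]
        · simp [hxz, Ne.symm hzw, h10]
    · by_cases hxw : x = w
      · subst hxw
        by_cases hzy : z = y
        · subst hzy
          rw [Finset.prod_eq_one]
          · simp [hxz]
          · intro i _
            by_cases h1 : x = i
            · subst h1; simp [Ne.symm hxz, h11]
            · by_cases h2 : z = i
              · subst h2; simp [h1, h11]
              · simp [h1, h2, h00]
        · rw [Finset.prod_eq_zero (Finset.mem_univ z)]
          · simp [hxz, hxy, Ne.symm hzy]
          · simp [hxz, Ne.symm hzy, h10]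
      · rw [Finset.prod_eq_zero (Finset.mem_univ x)]
        · simp [hxz, hxy, hxw]
        · simp [Ne.symm hxz, Ne.symm hxy, Ne.symm hxw, h10]

theorem integral_pi_tScore_mul_four (hν : ∀ i, 2 < ν i) (x y z w : ι) :
    Integrable (fun v : ι → ℝ => (tScore (ν x) (v x) * v y) * (tScore (ν z) (v z) * v w))
      (Measure.pi fun i => tStd (ν i)) ∧
    ∫ v : ι → ℝ, (tScore (ν x) (v x) * v y) * (tScore (ν z) (v z) * v w)
      ∂(Measure.pi fun i => tStd (ν i)) =
      covEntry ν x y z w + if x = y ∧ z = w then 1 else 0 := by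
  have h := integral_pi_tScore_pow hν
    (fun i => (if x = i then 1 else 0) + if z = i then 1 else 0)
    (b := fun i => (if y = i then 1 else 0) + if w = i then 1 else 0)
    (fun i => by split_ifs <;> omega)
  simp only [pow_add, Finset.prod_mul_distrib, Finset.prod_pow_boole, Finset.mem_univ,
    if_true] at h
  rw [prod_tMoment hν] at h
  have he : (fun v : ι → ℝ => (tScore (ν x) (v x) * v y) * (tScore (ν z) (v z) * v w)) =
      fun v => (tScore (ν x) (v x) * tScore (ν z) (v z)) * (v y * v w) :=
    funext fun v => mul_mul_mul_comm _ _ _ _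
  rw [he]
  simpa only [pow_ite, pow_one, pow_zero] using h

/-- The centred products `h_x U_y - δ_{xy}`. -/
noncomputable def centredProd (ν : ι → ℝ) (v : ι → ℝ) : ι × ι → ℝ :=
  fun q => tScore (ν q.1) (v q.1) * v q.2 - if q.1 = q.2 then 1 else 0

theorem integral_pi_centredProd_mul (hν : ∀ i, 2 < ν i) (q r : ι × ι) :
    Integrable (fun v : ι → ℝ => centredProd ν v q * centredProd ν v r)
      (Measure.pi fun i => tStd (ν i)) ∧
    ∫ v : ι → ℝ, centredProd ν v q * centredProd ν v r ∂(Measure.pi fun i => tStd (ν i)) =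
      covEntry ν q.1 q.2 r.1 r.2 := by
  have := fun i => isProbabilityMeasure_tStd (hν i)
  obtain ⟨i1, e1⟩ := integral_pi_tScore_mul hν q.1 q.2
  obtain ⟨i2, e2⟩ := integral_pi_tScore_mul hν r.1 r.2
  obtain ⟨i3, e3⟩ := integral_pi_tScore_mul_four hν q.1 q.2 r.1 r.2
  set c : ℝ := if q.1 = q.2 then 1 else 0
  set d : ℝ := if r.1 = r.2 then 1 else 0
  have hcd : (if q.1 = q.2 ∧ r.1 = r.2 then (1 : ℝ) else 0) = c * d := by
    by_cases h1 : q.1 = q.2 <;> by_cases h2 : r.1 = r.2 <;> simp [c, d, h1, h2]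
  have he : (fun v : ι → ℝ => centredProd ν v q * centredProd ν v r) = fun v =>
      (tScore (ν q.1) (v q.1) * v q.2) * (tScore (ν r.1) (v r.1) * v r.2) -
        d * (tScore (ν q.1) (v q.1) * v q.2) - c * (tScore (ν r.1) (v r.1) * v r.2) + c * d := by
    ext v
    simp only [centredProd, c, d]
    ring
  have i4 := i3.sub (i1.const_mul d)
  have i5 := i4.sub (i2.const_mul c)
  rw [he]
  refine ⟨i5.add (integrable_const (c * d)), ?_⟩
  have e4 := integral_add i5 (integrable_const (c * d))
  rw [integral_sub' i4 (i2.const_mul c), integral_sub' i3 (i1.const_mul d), integral_const_mul,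
    integral_const_mul, e1, e2, e3, hcd] at e4
  refine e4.trans ?_
  simp
  ring

/-- Each pattern of coincidences in the covariance determines `r` from `q` and collapses the inner
sum. -/
theorem sum_covEntry (ν : ι → ℝ) (f g : ι × ι → ℝ) :
    ∑ q : ι × ι, ∑ r : ι × ι, f q * covEntry ν q.1 q.2 r.1 r.2 * g r =
      ∑ x, ∑ y, f (x, y) * g (y, x) + ∑ x, ∑ y, psi (ν x) * f (x, y) * g (x, y) +
        ∑ x, (3 * phi (ν x) - 2 - psi (ν x)) * f (x, x) * g (x, x) := by
  have h1 : ∀ q : ι × ι, ∑ r : ι × ι, f q * covEntry ν q.1 q.2 r.1 r.2 * g r =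
      f q * g (q.2, q.1) + psi (ν q.1) * f q * g q +
        if q.1 = q.2 then (3 * phi (ν q.1) - 2 - psi (ν q.1)) * f q * g q else 0 := by
    intro q
    have h2 : ∀ r : ι × ι, f q * covEntry ν q.1 q.2 r.1 r.2 * g r =
        (if r = (q.2, q.1) then f q * g r else 0) + (if r = q then psi (ν q.1) * f q * g r else 0) +
        if r = q then (if q.1 = q.2 then (3 * phi (ν q.1) - 2 - psi (ν q.1)) * f q * g r else 0)
          else 0 := by
      rintro ⟨z, w⟩
      obtain ⟨x, y⟩ := q
      have a1 : (x = w ∧ y = z) ↔ (z, w) = (y, x) := by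
        rw [Prod.mk.injEq]; constructor <;> rintro ⟨rfl, rfl⟩ <;> exact ⟨rfl, rfl⟩
      have a2 : (x = z ∧ y = w) ↔ (z, w) = (x, y) := by
        rw [Prod.mk.injEq]; constructor <;> rintro ⟨rfl, rfl⟩ <;> exact ⟨rfl, rfl⟩
      have a3 : (x = y ∧ y = z ∧ z = w) ↔ (z, w) = (x, y) ∧ x = y := by
        rw [Prod.mk.injEq]; constructor
        · rintro ⟨rfl, rfl, rfl⟩; exact ⟨⟨rfl, rfl⟩, rfl⟩
        · rintro ⟨⟨rfl, rfl⟩, rfl⟩; exact ⟨rfl, rfl, rfl⟩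
      simp only [covEntry, a1, a2, a3, ite_and, mul_add, add_mul, mul_ite, ite_mul, mul_one,
        mul_zero, zero_mul]
      congr 2 <;> split_ifs <;> ring
    simp only [h2, Finset.sum_add_distrib, Finset.sum_ite_eq', Finset.mem_univ, if_true]
  simp only [h1, Finset.sum_add_distrib, Fintype.sum_prod_type, Finset.sum_ite_eq,
    Finset.mem_univ, if_true]

end PiMoments

theorem centredProd_eq_weight {ι : Type*} [DecidableEq ι] (ν u : ι → ℝ) (x y : ι) :
    centredProd ν u (x, y) = weight ν u x * u x * u y - if x = y then 1 else 0 := rfl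

/-! ### The information matrix -/

section Information

variable {K : ℕ} {n : Fin K → ℕ}

/-- The matrix of the linear map `E ↦ vec (V' E V)`, `V = clusterMat n`, in the entries of `E`. -/
noncomputable def clusterLin (n : Fin K → ℕ) : Matrix (Fin K × Fin K) (Idx n × Idx n) ℝ :=
  Matrix.of fun p q => clusterMat n q.1 p.2 * clusterMat n q.2 p.1

/-- The coefficients of `S` as a linear form in the centred products. -/
noncomputable def withinLin (n : Fin K → ℕ) (A : Matrix (Fin K) (Fin K) ℝ) :
    Matrix (Fin K) (Idx n × Idx n) ℝ :=
  Matrix.of fun k q => -((((n k : ℝ) - 1) * lam n A k)⁻¹ *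
    if q.1.1 = k then withinProj n q.1 q.2 else 0)

theorem sum_mul_clusterMat_mul (f : Idx n → ℝ) (a b : Fin K) :
    ∑ x, f x * (clusterMat n x a * clusterMat n x b) =
      if a = b then (n a : ℝ)⁻¹ * ∑ i, f ⟨a, i⟩ else 0 := by
  by_cases h : a = b
  · subst h
    have h1 : ∀ x : Idx n, f x * (clusterMat n x a * clusterMat n x a) =
        if x.1 = a then (n a : ℝ)⁻¹ * f x else 0 := by
      intro x
      simp only [clusterMat, of_apply]
      split_ifs
      · rw [one_div_sqrt_mul_self, mul_comm]
      · simp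
    simp only [h1, sum_idx_ite, if_true, Finset.mul_sum]
  · rw [if_neg h]
    refine Finset.sum_eq_zero fun x _ => ?_
    by_cases hx : x.1 = a
    · have : x.1 ≠ b := fun e => h (hx ▸ e)
      simp [clusterMat, this]
    · simp [clusterMat, hx]

theorem sum_clusterMat_mul (hn : ∀ k, 2 ≤ n k) (a b : Fin K) :
    ∑ x, clusterMat n x a * clusterMat n x b = if a = b then 1 else 0 := by
  have := congrFun (congrFun (clusterMat_transpose_mul_self hn) a) b
  rwa [one_apply] at this

theorem sum_withinProj_mul_clusterMat (hn : ∀ k, 2 ≤ n k) (x : Idx n) (a : Fin K) :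
    ∑ y, withinProj n x y * clusterMat n y a = 0 :=
  congrFun (congrFun (withinProj_mul_clusterMat hn) x) a

theorem sum_withinProj_sq (hn : ∀ k, 2 ≤ n k) (x : Idx n) :
    ∑ y, withinProj n x y * withinProj n x y = 1 - (n x.1 : ℝ)⁻¹ := by
  have h := congrFun (congrFun (withinProj_mul_self hn) x) x
  rw [withinProj_apply, if_pos rfl, if_pos rfl] at h
  rw [← h, mul_apply]
  refine Finset.sum_congr rfl fun y _ => ?_
  congr 1
  exact congrFun (congrFun (withinProj_transpose (n := n)) y) x

theorem mean_kappa (hn : ∀ k, 2 ≤ n k) (ν : Idx n → ℝ) (k : Fin K) :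
    (n k : ℝ)⁻¹ * ∑ i, (3 * phi (ν ⟨k, i⟩) - 2 - psi (ν ⟨k, i⟩)) =
      3 * phiBar n ν k - 2 - psiBar n ν k := by
  have := (natCast_pos_of_two_le hn k).ne'
  rw [Finset.sum_sub_distrib, Finset.sum_sub_distrib, ← Finset.mul_sum, phiBar, psiBar]
  simp
  field_simp

theorem mean_psi (ν : Idx n → ℝ) (k : Fin K) :
    (n k : ℝ)⁻¹ * ∑ i, psi (ν ⟨k, i⟩) = psiBar n ν k := by
  rw [psiBar, one_div]

theorem Jmat_apply (k i j : Fin K) : Jmat k i j = if i = k ∧ j = k then 1 else 0 := by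
  simp only [Jmat, stdVec, vecMulVec_apply, Pi.single_apply, ite_and, mul_ite, mul_one, mul_zero]
  split_ifs <;> rfl

theorem Upsilon_apply (ν : Idx n → ℝ) (p q : Fin K × Fin K) :
    Upsilon n ν p q =
      (if p.1 = q.1 ∧ p.2 = q.2 then psiBar n ν p.2 else 0) +
      if p.2 = p.1 ∧ q.2 = q.1 ∧ p.2 = q.2 then
        (n p.2 : ℝ)⁻¹ * (3 * phiBar n ν p.2 - 2 - psiBar n ν p.2) else 0 := by
  obtain ⟨p1, p2⟩ := p
  obtain ⟨q1, q2⟩ := q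
  simp only [Upsilon, Matrix.sum_apply, Matrix.add_apply, Matrix.smul_apply, kroneckerMap_apply,
    Jmat_apply, one_apply, smul_eq_mul]
  rw [Finset.sum_eq_single p2]
  · by_cases h1 : p1 = q1 <;> by_cases h2 : q2 = p2 <;> by_cases h3 : p1 = p2 <;>
      by_cases h4 : q1 = p2 <;>
      simp_all [eq_comm, add_comm]
  · intro k _ hk
    simp [Ne.symm hk]
  · simp

theorem Theta_apply (ν : Idx n → ℝ) (A : Matrix (Fin K) (Fin K) ℝ) (k : Fin K)
    (q : Fin K × Fin K) :
    Theta n ν A k q = if q.2 = k ∧ q.1 = k then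
      (lam n A k)⁻¹ * (n k : ℝ)⁻¹ * (psiBar n ν k + 2 - 3 * phiBar n ν k) else 0 := by
  simp only [Theta, Matrix.sum_apply, Matrix.smul_apply, vecMulVec_apply, vec, Jmat_apply,
    smul_eq_mul, stdVec, Pi.single_apply]
  rw [Finset.sum_eq_single k]
  · simp
  · intro l _ hl
    simp [Ne.symm hl]
  · simp

/-- The covariance matrix of the centred products. -/
noncomputable def covMat (ν : Idx n → ℝ) : Matrix (Idx n × Idx n) (Idx n × Idx n) ℝ :=
  Matrix.of fun q r => covEntry ν q.1 q.2 r.1 r.2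

theorem covMat_transpose (ν : Idx n → ℝ) : (covMat ν)ᵀ = covMat ν := by
  ext ⟨x, y⟩ ⟨z, w⟩
  have a1 : (z = y ∧ w = x) ↔ (x = w ∧ y = z) := by
    constructor <;> rintro ⟨rfl, rfl⟩ <;> exact ⟨rfl, rfl⟩
  have a3 : (z = w ∧ w = x ∧ x = y) ↔ (x = y ∧ y = z ∧ z = w) := by
    constructor <;> rintro ⟨rfl, rfl, rfl⟩ <;> exact ⟨rfl, rfl, rfl⟩
  simp only [transpose_apply, covMat, of_apply, covEntry, a1, a3]
  congr 1
  · congr 1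
    by_cases h : x = z
    · subst h
      simp [eq_comm]
    · simp [h, Ne.symm h]
  · by_cases h : x = y ∧ y = z ∧ z = w
    · obtain ⟨rfl, rfl, rfl⟩ := h
      rfl
    · rw [if_neg h, if_neg h]

theorem mul_covMat_mul_transpose {l m : Type*} (ν : Idx n → ℝ) (F : Matrix l (Idx n × Idx n) ℝ)
    (G : Matrix m (Idx n × Idx n) ℝ) (i : l) (j : m) :
    (F * covMat ν * Gᵀ) i j =
      ∑ x, ∑ y, F i (x, y) * G j (y, x) + ∑ x, ∑ y, psi (ν x) * F i (x, y) * G j (x, y) +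
        ∑ x, (3 * phi (ν x) - 2 - psi (ν x)) * F i (x, x) * G j (x, x) := by
  rw [← sum_covEntry]
  simp only [mul_apply, transpose_apply, covMat, of_apply, Finset.sum_mul]
  exact Finset.sum_comm

/-- By `V'V = 1`, the crossed pairing gives `K_K` and the `ψ` pairing gives `ψ̄_k (I ⊗ J_k)`. The
diagonal term carries four entries of `V`, that is `n_k⁻²`, of which one factor is absorbed by the
cluster average. -/
theorem clusterLin_mul_covMat (hn : ∀ k, 2 ≤ n k) (ν : Idx n → ℝ) :
    clusterLin n * covMat ν * (clusterLin n)ᵀ = commMat (Fin K) + Upsilon n ν := by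
  ext ⟨p1, p2⟩ ⟨q1, q2⟩
  rw [mul_covMat_mul_transpose, Matrix.add_apply, Upsilon_apply, add_assoc]
  simp only [clusterLin, of_apply]
  congr 1
  · have h : ∑ x, ∑ y, clusterMat n x p2 * clusterMat n y p1 * (clusterMat n y q2 * clusterMat n x q1)
        = (∑ x, clusterMat n x p2 * clusterMat n x q1) *
          ∑ y, clusterMat n y p1 * clusterMat n y q2 := by
      rw [Finset.sum_mul_sum]
      exact Finset.sum_congr rfl fun x _ => Finset.sum_congr rfl fun y _ => by ring
    rw [h, sum_clusterMat_mul hn, sum_clusterMat_mul hn, commMat, of_apply]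
    simp only [Prod.swap_prod_mk, Prod.mk.injEq, ite_and, mul_ite, mul_one, mul_zero]
  congr 1
  · have h : ∑ x, ∑ y, psi (ν x) * (clusterMat n x p2 * clusterMat n y p1) *
          (clusterMat n x q2 * clusterMat n y q1)
        = (∑ x, psi (ν x) * (clusterMat n x p2 * clusterMat n x q2)) *
          ∑ y, clusterMat n y p1 * clusterMat n y q1 := by
      rw [Finset.sum_mul_sum]
      exact Finset.sum_congr rfl fun x _ => Finset.sum_congr rfl fun y _ => by ring
    rw [h, sum_clusterMat_mul hn, sum_mul_clusterMat_mul, mean_psi]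
    simp only [ite_and, mul_ite, mul_one, mul_zero]
  · by_cases hp : p2 = p1
    · subst hp
      by_cases hq : q2 = q1
      · subst hq
        have h : ∀ x : Idx n, (3 * phi (ν x) - 2 - psi (ν x)) *
            (clusterMat n x p2 * clusterMat n x p2) * (clusterMat n x q2 * clusterMat n x q2) =
            (n p2 : ℝ)⁻¹ * ((3 * phi (ν x) - 2 - psi (ν x)) *
              (clusterMat n x p2 * clusterMat n x q2)) := by
          intro x
          by_cases hx : x.1 = p2
          · by_cases hx' : x.1 = q2
            · have e : q2 = p2 := hx' ▸ hx
              subst e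
              simp only [clusterMat, of_apply, if_pos hx, one_div_sqrt_mul_self]
              ring
            · simp [clusterMat, hx']
          · simp [clusterMat, hx]
        simp only [h, ← Finset.mul_sum, sum_mul_clusterMat_mul, mean_kappa hn]
        simp
      · rw [if_neg fun h => hq h.2.1]
        refine Finset.sum_eq_zero fun x _ => ?_
        by_cases hx : x.1 = q2
        · have : x.1 ≠ q1 := fun e => hq (hx ▸ e)
          simp [clusterMat, this]
        · simp [clusterMat, hx]
    · rw [if_neg fun h => hp h.1]
      refine Finset.sum_eq_zero fun x _ => ?_
      by_cases hx : x.1 = p2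
      · have : x.1 ≠ p1 := fun e => hp (hx ▸ e)
        simp [clusterMat, this]
      · simp [clusterMat, hx]

/-- `PV = 0` kills both pairings. Only the diagonal correction remains, with `P_{xx}/(n_k - 1) =
1/n_k`. -/
theorem withinLin_mul_covMat_mul_clusterLin (hn : ∀ k, 2 ≤ n k) (ν : Idx n → ℝ)
    (A : Matrix (Fin K) (Fin K) ℝ) :
    withinLin n A * covMat ν * (clusterLin n)ᵀ = Theta n ν A := by
  ext k ⟨q1, q2⟩
  have hn0 := (natCast_pos_of_two_le hn k).ne'
  have hn1 := (natCast_sub_one_pos hn k).ne'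
  rw [mul_covMat_mul_transpose, Theta_apply]
  set c := (((n k : ℝ) - 1) * lam n A k)⁻¹ with hc
  simp only [withinLin, clusterLin, of_apply, ← hc]
  have h1 : ∑ x : Idx n, ∑ y, -(c * if x.1 = k then withinProj n x y else 0) *
      (clusterMat n y q2 * clusterMat n x q1) = 0 := by
    refine Finset.sum_eq_zero fun x _ => ?_
    have : ∀ y, -(c * if x.1 = k then withinProj n x y else 0) *
        (clusterMat n y q2 * clusterMat n x q1) = -(c * if x.1 = k then clusterMat n x q1 else 0) *
          (withinProj n x y * clusterMat n y q2) := by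
      intro y
      split_ifs <;> ring
    simp only [this, ← Finset.mul_sum, sum_withinProj_mul_clusterMat hn, mul_zero]
  have h2 : ∑ x : Idx n, ∑ y, psi (ν x) * -(c * if x.1 = k then withinProj n x y else 0) *
      (clusterMat n x q2 * clusterMat n y q1) = 0 := by
    refine Finset.sum_eq_zero fun x _ => ?_
    have : ∀ y, psi (ν x) * -(c * if x.1 = k then withinProj n x y else 0) *
        (clusterMat n x q2 * clusterMat n y q1) =
        psi (ν x) * -(c * if x.1 = k then clusterMat n x q2 else 0) *
          (withinProj n x y * clusterMat n y q1) := by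
      intro y
      split_ifs <;> ring
    simp only [this, ← Finset.mul_sum, sum_withinProj_mul_clusterMat hn, mul_zero]
  have h3 : ∀ x : Idx n, (3 * phi (ν x) - 2 - psi (ν x)) *
      -(c * if x.1 = k then withinProj n x x else 0) * (clusterMat n x q2 * clusterMat n x q1) =
      -(c * (1 - (n k : ℝ)⁻¹)) * if x.1 = k then (3 * phi (ν x) - 2 - psi (ν x)) *
        (clusterMat n x q2 * clusterMat n x q1) else 0 := by
    intro x
    rw [withinProj_apply, if_pos rfl, if_pos rfl]
    split_ifs with hx
    · rw [hx]; ring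
    · ring
  rw [h1, h2, zero_add, zero_add]
  simp only [h3, ← Finset.mul_sum, sum_idx_ite]
  by_cases hq : q2 = k ∧ q1 = k
  · obtain ⟨rfl, rfl⟩ := hq
    simp only [clusterMat, of_apply, if_true, one_div_sqrt_mul_self, and_self]
    rw [← Finset.sum_mul, mul_comm _ (n q1 : ℝ)⁻¹, mean_kappa hn, hc, mul_inv]
    field_simp
    ring
  · rw [if_neg hq]
    have : ∀ i, clusterMat n ⟨k, i⟩ q2 * clusterMat n ⟨k, i⟩ q1 = 0 := by
      intro i
      simp only [clusterMat, of_apply]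
      by_cases e2 : k = q2
      · have e1 : k ≠ q1 := fun e1 => hq ⟨e2.symm, e1.symm⟩
        simp [e1]
      · simp [e2]
    simp [this]

/-- Off the diagonal everything vanishes because `P` does not link clusters; on it, `∑_y P_{xy}² =
P_{xx} = 1 - 1/n_k` evaluates the pairings. -/
theorem withinLin_mul_covMat_mul_withinLin (hn : ∀ k, 2 ≤ n k) (ν : Idx n → ℝ)
    (A : Matrix (Fin K) (Fin K) ℝ) :
    withinLin n A * covMat ν * (withinLin n A)ᵀ = Xi n ν A := by
  ext k l
  rw [mul_covMat_mul_transpose, Xi]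
  set c : Fin K → ℝ := fun k => (((n k : ℝ) - 1) * lam n A k)⁻¹ with hc
  by_cases hkl : k = l
  · subst hkl
    have hn0 := (natCast_pos_of_two_le hn k).ne'
    have hn1 := (natCast_sub_one_pos hn k).ne'
    rw [diagonal_apply_eq]
    have h1 : ∀ x : Idx n, ∑ y, withinLin n A k (x, y) * withinLin n A k (y, x) =
        if x.1 = k then c k ^ 2 * (1 - (n k : ℝ)⁻¹) else 0 := by
      intro x
      split_ifs with hx
      · rw [← hx, ← sum_withinProj_sq hn x, Finset.mul_sum]
        refine Finset.sum_congr rfl fun y _ => ?_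
        have hs : withinProj n y x = withinProj n x y :=
          congrFun (congrFun (withinProj_transpose (n := n)) x) y
        simp only [withinLin, of_apply, hs]
        by_cases hy : y.1 = x.1
        · simp only [hy, if_true, c]; ring
        · have hxy : x ≠ y := fun e => hy (by rw [e])
          have : withinProj n x y = 0 := by
            rw [withinProj_apply, if_neg hxy, if_neg (Ne.symm hy), sub_zero]
          simp [this]
      · simp [withinLin, hx]
    have h2 : ∀ x : Idx n, ∑ y, psi (ν x) * withinLin n A k (x, y) * withinLin n A k (x, y) =
        if x.1 = k then c k ^ 2 * (1 - (n k : ℝ)⁻¹) * psi (ν x) else 0 := by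
      intro x
      split_ifs with hx
      · rw [mul_right_comm, ← hx, ← sum_withinProj_sq hn x, Finset.mul_sum]
        refine Finset.sum_congr rfl fun y _ => ?_
        simp only [withinLin, of_apply, if_true, c]
        ring
      · simp [withinLin, hx]
    have h3 : ∀ x : Idx n, (3 * phi (ν x) - 2 - psi (ν x)) * withinLin n A k (x, x) *
        withinLin n A k (x, x) = if x.1 = k then c k ^ 2 * (1 - (n k : ℝ)⁻¹) ^ 2 *
          (3 * phi (ν x) - 2 - psi (ν x)) else 0 := by
      intro x
      simp only [withinLin, of_apply, withinProj_apply, if_true]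
      split_ifs with hx
      · simp only [hx, c]; ring
      · ring
    simp only [h1, h2, h3, sum_idx_ite, ← Finset.mul_sum]
    have e1 := mean_psi ν k
    have e2 := mean_kappa hn ν k
    have e1' : ∑ i, psi (ν ⟨k, i⟩) = n k * psiBar n ν k := by
      rw [← e1]; field_simp
    have e2' : ∑ i, (3 * phi (ν ⟨k, i⟩) - 2 - psi (ν ⟨k, i⟩)) =
        n k * (3 * phiBar n ν k - 2 - psiBar n ν k) := by
      rw [← e2]; field_simp
    rw [e1', e2', hc]
    simp only [Finset.sum_const, Finset.card_univ, Fintype.card_fin, nsmul_eq_mul, mul_inv, ← inv_pow]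
    generalize (lam n A k)⁻¹ = m
    field_simp
    ring
  · rw [diagonal_apply_ne _ hkl]
    have h1 : ∀ x y : Idx n, withinLin n A k (x, y) * withinLin n A l (y, x) = 0 := by
      intro x y
      simp only [withinLin, of_apply]
      by_cases hx : x.1 = k
      · by_cases hy : y.1 = l
        · have h2 : x.1 ≠ y.1 := fun e => hkl (by rw [← hx, ← hy, e])
          have hxy : x ≠ y := fun e => h2 (by rw [e])
          have : withinProj n x y = 0 := by
            rw [withinProj_apply, if_neg hxy, if_neg h2, sub_zero]
          simp [this]
        · simp [hy]
      · simp [hx]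
    have h2 : ∀ x y : Idx n, withinLin n A k (x, y) * withinLin n A l (x, y) = 0 := by
      intro x y
      simp only [withinLin, of_apply]
      by_cases hx : x.1 = k
      · have : x.1 ≠ l := fun e => hkl (hx ▸ e)
        simp [this]
      · simp [hx]
    simp [h1, h2, mul_assoc]

theorem clusterLin_mulVec (hn : ∀ k, 2 ≤ n k) (ν u : Idx n → ℝ) :
    clusterLin n *ᵥ centredProd ν u =
      vec (vecMulVec ((clusterMat n)ᵀ *ᵥ fun x => weight ν u x * u x) ((clusterMat n)ᵀ *ᵥ u)) -
        vec (1 : Matrix (Fin K) (Fin K) ℝ) := by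
  ext ⟨p1, p2⟩
  simp only [mulVec, dotProduct, Fintype.sum_prod_type, centredProd_eq_weight, clusterLin, of_apply,
    mul_sub, Finset.sum_sub_distrib, Pi.sub_apply, vec, vecMulVec_apply, transpose_apply, mul_ite,
    mul_one, mul_zero, Finset.sum_ite_eq, Finset.mem_univ, if_true, sum_clusterMat_mul hn, one_apply]
  congr 1
  rw [Finset.sum_mul_sum]
  exact Finset.sum_congr rfl fun x _ => Finset.sum_congr rfl fun y _ => by ring

/-- The centring terms sum to the trace of `P` on cluster `k`, namely `n_k - 1`, which produces
exactly the constant `1/λ_k` in `S_k`. -/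
theorem withinLin_mulVec (hn : ∀ k, 2 ≤ n k) (ν u : Idx n → ℝ) (A : Matrix (Fin K) (Fin K) ℝ) :
    withinLin n A *ᵥ centredProd ν u = Svec n ν A u := by
  ext k
  have hn0 := (natCast_pos_of_two_le hn k).ne'
  have hn1 := (natCast_sub_one_pos hn k).ne'
  rw [Svec_eq]
  set c := (((n k : ℝ) - 1) * lam n A k)⁻¹ with hc
  have h1 : ∀ x : Idx n, ∑ y, withinLin n A k (x, y) * centredProd ν u (x, y) =
      c * (if x.1 = k then 1 - (n k : ℝ)⁻¹ else 0) -
        c * (if x.1 = k then weight ν u x * u x * (withinProj n *ᵥ u) x else 0) := by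
    intro x
    simp only [withinLin, of_apply, ← hc, centredProd_eq_weight]
    split_ifs with hx
    · have h2 : ∀ y, -(c * withinProj n x y) *
          (weight ν u x * u x * u y - if x = y then 1 else 0) =
          (if x = y then c * withinProj n x y else 0) -
            c * (weight ν u x * u x) * (withinProj n x y * u y) := by
        intro y
        split_ifs <;> ring
      simp only [h2, Finset.sum_sub_distrib, Finset.sum_ite_eq, Finset.mem_univ, if_true,
        ← Finset.mul_sum]
      rw [withinProj_apply, if_pos rfl, if_pos rfl, hx, mul_assoc c]
      rfl
    · simp
  simp only [mulVec, dotProduct, Fintype.sum_prod_type] at h1 ⊢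
  simp only [h1, Finset.sum_sub_distrib, ← Finset.mul_sum, sum_idx_ite]
  simp only [Finset.sum_const, Finset.card_univ, Fintype.card_fin, nsmul_eq_mul]
  rw [hc, div_eq_inv_mul _ (((n k : ℝ) - 1) * lam n A k)]
  congr 1
  rw [mul_inv, one_div]
  field_simp

/-- The coefficients of the score as a linear form in the centred products. -/
noncomputable def scoreLin (n : Fin K → ℕ) (A : Matrix (Fin K) (Fin K) ℝ) :
    Matrix (Fin K × Fin K) (Idx n × Idx n) ℝ :=
  OmegaA A * clusterLin n + (1 / 2 : ℝ) • ((elimDiag (Fin K))ᵀ * withinLin n A)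

/-- `X₀` consists of the normalized cluster means of `U`, so the products of `h` with `X₀` are
linear in the `h_x U_y`. -/
theorem X0_eq (hn : ∀ k, 2 ≤ n k) {A : Matrix (Fin K) (Fin K) ℝ} (hA : (corrOfA n A).PosDef)
    (z : Idx n → ℝ) : X0 n A z = (clusterMat n)ᵀ *ᵥ stdU (corrOfA n A) z := by
  have hAp := posDef_of_posDef_corrOfA hn hA
  rw [stdU, invSqrtm_corrOfA hn (sqrtm_mul_sqrtm hAp) (posDef_sqrtm hAp).accretive
    (lam_pos_of_posDef_corrOfA hn hA), mulVec_mulVec, clusterMat_transpose_mul_blockMat hn,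
    ← mulVec_mulVec, X0, Y0_eq, invSqrtm]

theorem scoreA_eq_scoreLin_mulVec (hn : ∀ k, 2 ≤ n k) {ν : Idx n → ℝ} (hν : ∀ x, 2 < ν x)
    {A : Matrix (Fin K) (Fin K) ℝ} (hA : (corrOfA n A).PosDef) (z : Idx n → ℝ) :
    scoreA n ν A z = scoreLin n A *ᵥ centredProd ν (stdU (corrOfA n A) z) := by
  rw [scoreA_eq hn hν hA, X0_eq hn hA, scoreLin, add_mulVec, ← mulVec_mulVec,
    clusterLin_mulVec hn, smul_mulVec, ← mulVec_mulVec, withinLin_mulVec hn]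

/-- Expanding the square gives four blocks; symmetry of the covariance and of `Ω_A` makes the two
mixed ones transposes of each other. -/
theorem scoreLin_mul_covMat (hn : ∀ k, 2 ≤ n k) (ν : Idx n → ℝ)
    {A : Matrix (Fin K) (Fin K) ℝ} (hA : A.PosDef) :
    scoreLin n A * covMat ν * (scoreLin n A)ᵀ =
      OmegaA A * (commMat (Fin K) + Upsilon n ν) * OmegaA A +
        (1 / 4 : ℝ) • ((elimDiag (Fin K))ᵀ * Xi n ν A * elimDiag (Fin K)) +
        (1 / 2 : ℝ) • ((elimDiag (Fin K))ᵀ * Theta n ν A * OmegaA A) +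
        (1 / 2 : ℝ) • (OmegaA A * (Theta n ν A)ᵀ * elimDiag (Fin K)) := by
  have h := withinLin_mul_covMat_mul_clusterLin hn ν A
  have ht : clusterLin n * covMat ν * (withinLin n A)ᵀ = (Theta n ν A)ᵀ := by
    rw [← h, transpose_mul, transpose_mul, transpose_transpose, covMat_transpose, Matrix.mul_assoc]
  rw [← withinLin_mul_covMat_mul_withinLin hn ν A, ← clusterLin_mul_covMat hn ν, ← ht, ← h,
    scoreLin, transpose_add, transpose_mul, transpose_smul, transpose_mul, transpose_transpose,
    OmegaA_transpose hA]
  simp only [Matrix.add_mul, Matrix.mul_add, Matrix.smul_mul, Matrix.mul_smul, Matrix.mul_assoc,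
    smul_add, smul_smul]
  norm_num
  abel

theorem hasLaw_stdU_heteroT {ι : Type*} [Fintype ι] [DecidableEq ι] (ν : ι → ℝ)
    {C : Matrix ι ι ℝ} (hC : C.PosDef) :
    HasLaw (stdU C) (Measure.pi fun i => tStd (ν i)) (heteroT ν (sqrtm C)) := by
  have hm : ∀ M : Matrix ι ι ℝ, Measurable fun v : ι → ℝ => M *ᵥ v := fun M =>
    (Continuous.matrix_mulVec continuous_const continuous_id).measurable
  refine ⟨(hm _).aemeasurable, ?_⟩
  have hs : (stdU C) ∘ (fun v => sqrtm C *ᵥ v) = id := by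
    ext1 v
    simp only [Function.comp, stdU, invSqrtm, mulVec_mulVec, id,
      nonsing_inv_mul _ ((isUnit_iff_isUnit_det _).mp (posDef_sqrtm hC).isUnit), one_mulVec]
  have hst : Measurable (stdU C) := hm _
  rw [heteroT, Measure.map_map hst (hm _), hs, Measure.map_id]

theorem measurable_centredProd {ι : Type*} [DecidableEq ι] {ν : ι → ℝ} (hν : ∀ i, 2 < ν i)
    (q : ι × ι) : Measurable fun v : ι → ℝ => centredProd ν v q := by
  have h := (continuous_tScore (hν q.1)).measurable
  unfold centredProd
  fun_prop

/-- Second moments of linear forms in the centred products. -/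
theorem integral_mulVec_centredProd_mul {l : Type*} {ν : Idx n → ℝ} (hν : ∀ x, 2 < ν x)
    {Ω : Type*} [MeasurableSpace Ω] {P : Measure Ω} {U : Ω → Idx n → ℝ}
    (hU : HasLaw U (Measure.pi fun x => tStd (ν x)) P) (B : Matrix l (Idx n × Idx n) ℝ) (p q : l) :
    Integrable (fun ω => (B *ᵥ centredProd ν (U ω)) p * (B *ᵥ centredProd ν (U ω)) q) P ∧
    ∫ ω, (B *ᵥ centredProd ν (U ω)) p * (B *ᵥ centredProd ν (U ω)) q ∂P =
      (B * covMat ν * Bᵀ) p q := by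
  have he : ∀ ω, (B *ᵥ centredProd ν (U ω)) p * (B *ᵥ centredProd ν (U ω)) q =
      ∑ r, ∑ s, B p r * B q s * (centredProd ν (U ω) r * centredProd ν (U ω) s) := by
    intro ω
    simp only [mulVec, dotProduct]
    rw [Finset.sum_mul_sum]
    exact Finset.sum_congr rfl fun r _ => Finset.sum_congr rfl fun s _ => by ring
  have hm : ∀ r s, AEStronglyMeasurable (fun v => centredProd ν v r * centredProd ν v s)
      (Measure.pi fun x => tStd (ν x)) := fun r s =>
    ((measurable_centredProd hν r).mul (measurable_centredProd hν s)).aestronglyMeasurable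
  have hi : ∀ r s, Integrable (fun ω => centredProd ν (U ω) r * centredProd ν (U ω) s) P := by
    intro r s
    have h := (integral_pi_centredProd_mul hν r s).1
    rw [← hU.map_eq] at h
    exact h.comp_aemeasurable hU.aemeasurable
  have hv : ∀ r s, ∫ ω, centredProd ν (U ω) r * centredProd ν (U ω) s ∂P = covMat ν r s :=
    fun r s => (hU.integral_comp (hm r s)).trans (integral_pi_centredProd_mul hν r s).2
  simp only [he]
  refine ⟨integrable_finsetSum _ fun r _ => integrable_finsetSum _ fun s _ =>
    (hi r s).const_mul _, ?_⟩
  rw [integral_finsetSum _ fun r _ => integrable_finsetSum _ fun s _ => (hi r s).const_mul _]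
  simp only [mul_apply, transpose_apply, Finset.sum_mul]
  rw [Finset.sum_comm]
  refine Finset.sum_congr rfl fun r _ => ?_
  rw [integral_finsetSum _ fun s _ => (hi r s).const_mul _]
  refine Finset.sum_congr rfl fun s _ => ?_
  rw [integral_const_mul, hv]
  ring

end Information

end HeteroBlock

/-! ### The theorem -/

open HeteroBlock in
theorem theorem5 {K : ℕ} (n : Fin K → ℕ) (hn : ∀ k, 2 ≤ n k)
    (ν : Idx n → ℝ) (hν : ∀ x, 2 < ν x)
    (ρ : Matrix (Fin K) (Fin K) ℝ) (C : Matrix (Idx n) (Idx n) ℝ) (hC : C = blockCorr n ρ)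
    (hpos : C.PosDef) (A : Matrix (Fin K) (Fin K) ℝ) (hA : A = canonA n ρ)
    {Ω : Type*} [MeasurableSpace Ω] (P : Measure Ω) (Z : Ω → Idx n → ℝ)
    (hZ : HasLaw Z (heteroT ν (sqrtm C)) P) :
    (∀ z : Idx n → ℝ,
      DifferentiableAt ℝ (logLikVecA n ν z) (vec A) ∧
      scoreA n ν A z =
        OmegaA A *ᵥ
          ((∑ k, ∑ i : Fin (n k),
              (weight ν (stdU C z) ⟨k, i⟩ * stdU C z ⟨k, i⟩ * (n k : ℝ) ^ (-(1 / 2) : ℝ)) •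
                vec (vecMulVec (stdVec k) (X0 n A z))) -
            vec (1 : Matrix (Fin K) (Fin K) ℝ)) +
        (1 / 2 : ℝ) • ((elimDiag (Fin K))ᵀ *ᵥ Svec n ν A (stdU C z))) ∧
    (∀ p q, Integrable (fun ω => scoreA n ν A (Z ω) p * scoreA n ν A (Z ω) q) P) ∧
    infoA n ν A P Z =
      OmegaA A * (commMat (Fin K) + Upsilon n ν) * OmegaA A +
        (1 / 4 : ℝ) • ((elimDiag (Fin K))ᵀ * Xi n ν A * elimDiag (Fin K)) +
        (1 / 2 : ℝ) • ((elimDiag (Fin K))ᵀ * Theta n ν A * OmegaA A) +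
        (1 / 2 : ℝ) • (OmegaA A * (Theta n ν A)ᵀ * elimDiag (Fin K)) := by
  have hCA : corrOfA n A = C := by rw [hA, hC, corrOfA_canonA hn]
  have hpos' : (corrOfA n A).PosDef := by rwa [hCA]
  have hAp := posDef_of_posDef_corrOfA hn hpos'
  have hU : HasLaw (fun ω => stdU (corrOfA n A) (Z ω)) (Measure.pi fun x => tStd (ν x)) P := by
    rw [← hCA] at hZ
    exact (hasLaw_stdU_heteroT ν hpos').comp hZ
  have hmom := integral_mulVec_centredProd_mul hν hU (scoreLin n A)
  simp only [← scoreA_eq_scoreLin_mulVec hn hν hpos', scoreLin_mul_covMat hn ν hAp] at hmom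
  refine ⟨fun z => ⟨(differentiableAt_logLikVecA hn hν hpos' z).2.2, ?_⟩,
    fun p q => (hmom p q).1, ?_⟩
  · rw [scoreA_eq hn hν hpos', hCA]
    congr 3
    ext ⟨p1, p2⟩
    simp only [Finset.sum_apply, Pi.smul_apply, smul_eq_mul, vec, vecMulVec_apply, ← mul_assoc,
      ← Finset.sum_mul]
    congr 1
    have hr : ∀ k, (n k : ℝ) ^ (-(1 / 2) : ℝ) = 1 / √(n k : ℝ) := fun k => by
      rw [Real.rpow_neg (Nat.cast_nonneg _), ← Real.sqrt_eq_rpow, one_div]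
    -- Row `p2` of `∑_k e_k X₀'` involves only `k = p2`, and the factor `n_k^{-1/2}` is the nonzero
    -- entry of column `k` of `V`.
    rw [Finset.sum_eq_single p2]
    · simp only [mulVec, dotProduct, transpose_apply, clusterMat, of_apply, ite_mul, zero_mul,
        sum_idx_ite, hr, stdVec, Pi.single_eq_same, mul_one]
      rw [← Finset.mul_sum, mul_comm]
    · intro k _ hk
      simp [stdVec, Ne.symm hk]
    · simp
  · ext p q
    exact (hmom p q).2
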